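/- Let $A$ be a unital $C^*$-algebra, $E$ a right Hilbert $A$-module (complete, with an $A$-valued inner product that is linear in the second variable, $\langle x, ya\rangle=\langle x,y\rangle a$), $B(E)$ the $C^*$-algebra of adjointable operators on $E$, and $\varphi: A\to B(E)$ a unital $*$-homomorphism, so that $(A,E,\varphi)$ is a $C^*$-correspondence. It is called faithful if $\varphi$ is injective, full if the closed linear span of $\{\langle x,y\rangle : x,y\in E\}$ is $A$, and finitely generated if $E$ is a finitely generated right $A$-module. Let $K(E)\subseteq B(E)$ be the closed linear span of the operators $|e\rangle\langle f| : x\mapsto e\langle f,x\rangle$, $e,f\in E$. Let $\mathcal F(E)=A\oplus E\oplus E^{\otimes 2}\oplus\cdots$ be the Fock space (tensor powers over $A$ as Hilbert modules, via $\varphi$), and let $\mathcal T_E\subseteq B(\mathcal F(E))$ be the $C^*$-subalgebra generated by the creation operators $\xi\mapsto e\otimes\xi$, $e\in E$, and by $A$ acting diagonally from the left; write $e$ and $a$ for the corresponding elements of $\mathcal T_E$. Let $\psi_1: K(E)\to\mathcal T_E$ be the $*$-homomorphism with $\psi_1(|e\rangle\langle f|)=ef^*$, let $$J_E=\varphi^{-1}(K(E))\cap(\ker\varphi)^\perp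 ,\qquad (\ker\varphi)^\perp=\{a\in A : ab=ba=0 \text{ for all } b\in\ker\varphi\},$$ and let the Cuntz–Pimsner algebra $\mathcal O_E$ be the quotient of $\mathcal T_E$ by the closed two-sided ideal generated by the elements $a-\psi_1(\varphi(a))$, $a\in J_E$. The gauge action of the circle $\mathbb S^1$ on $\mathcal O_E$ is the action by automorphisms that fixes (the image of) every $a\in A$ and sends (the image of) every $e\in E$ to $ze$, $z\in\mathbb S^1$. A continuous action of a compact group $G$ on a unital $C^*$-algebra $B$, with associated coaction $\rho:B\to B\otimes C(G)\cong C(G,B)$, $\rho(b)(g)=g\cdot b$, is called free if the linear span of $\{(a\otimes 1)\rho(b) : a,b\in B\}$ is norm dense in $B\otimes C(G)$. **Proposition.** If $(A,E,\varphi)$ is a faithful, full, finitely generated $C^*$-correspondence, then the gauge action of $\mathbb S^1$ on $\mathcal O_E$ is free. -/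

import Mathlib

set_option linter.unusedSectionVars false

noncomputable section

namespace CuntzPimsner

open MulOpposite

section HilbertModules

instance starOrderedRingMulOpposite (A : Type*) [CStarAlgebra A] [PartialOrder A]
    [StarOrderedRing A] : StarOrderedRing Aᵐᵒᵖ :=
  StarOrderedRing.of_nonneg_iff' (fun {x y} h z => by
    change (z + x).unop ≤ (z + y).unop
    simpa using (show x.unop ≤ y.unop from h)) fun x => by
    change 0 ≤ x.unop ↔ _
    rw [CStarAlgebra.nonneg_iff_eq_mul_star_self]
    constructor
    · rintro ⟨b, hb⟩
      exact ⟨op b, unop_injective (by simp [hb])⟩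
    · rintro ⟨b, hb⟩
      exact ⟨b.unop, by simp [hb]⟩

variable (A : Type*) [CStarAlgebra A] [PartialOrder A] [StarOrderedRing A]
variable {E : Type*} [NormedAddCommGroup E] [NormedSpace ℂ E] [Module Aᵐᵒᵖ E] [CStarModule Aᵐᵒᵖ E]

/-- The `A`-valued inner product of a right Hilbert `A`-module. In Mathlib's convention
`⟪x, a • y⟫ = a * ⟪x, y⟫`, so a right Hilbert `A`-module is a `CStarModule` over `Aᵐᵒᵖ`. Read in
`A`, the inner product satisfies `⟪x, y a⟫ = ⟪x, y⟫ a`, see `ip_op_smul_right`. -/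
def ip (x y : E) : A := (inner Aᵐᵒᵖ x y).unop

lemma ip_add_right (x y z : E) : ip A x (y + z) = ip A x y + ip A x z := by simp [ip]
lemma ip_add_left (x y z : E) : ip A (x + y) z = ip A x z + ip A y z := by simp [ip]
lemma ip_smul_right (c : ℂ) (x y : E) : ip A x (c • y) = c • ip A x y := by simp [ip]
lemma ip_smul_left (c : ℂ) (x y : E) : ip A (c • x) y = star c • ip A x y := by
  simp [ip]
lemma ip_op_smul_right (a : A) (x y : E) : ip A x (op a • y) = ip A x y * a := by simp [ip]
lemma ip_op_smul_left (a : A) (x y : E) : ip A (op a • x) y = star a * ip A x y := by simp [ip]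
lemma star_ip (x y : E) : star (ip A x y) = ip A y x := by
  simp only [ip]
  rw [← unop_star, CStarModule.star_inner]
lemma ip_self_nonneg (x : E) : 0 ≤ ip A x x :=
  (CStarModule.inner_self_nonneg : (0 : Aᵐᵒᵖ) ≤ inner Aᵐᵒᵖ x x)
lemma ip_zero_right (x : E) : ip A x 0 = 0 := by simp [ip]
lemma ip_zero_left (x : E) : ip A 0 x = 0 := by simp [ip]
lemma ip_sum_right {ι : Type*} (s : Finset ι) (x : E) (y : ι → E) :
    ip A x (∑ i ∈ s, y i) = ∑ i ∈ s, ip A x (y i) := by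
  simp [ip]
lemma ip_sum_left {ι : Type*} (s : Finset ι) (x : ι → E) (y : E) :
    ip A (∑ i ∈ s, x i) y = ∑ i ∈ s, ip A (x i) y := by
  simp [ip]
lemma norm_sq_eq (x : E) : ‖x‖ ^ 2 = ‖ip A x x‖ := by
  rw [CStarModule.norm_sq_eq Aᵐᵒᵖ]; rfl
lemma norm_ip_le (x y : E) : ‖ip A x y‖ ≤ ‖x‖ * ‖y‖ :=
  CStarModule.norm_inner_le (A := Aᵐᵒᵖ) E
lemma continuous_ip : Continuous fun p : E × E => ip A p.1 p.2 :=
  continuous_unop.comp (CStarModule.continuous_inner (A := Aᵐᵒᵖ))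

lemma ext_ip_left {x y : E} (h : ∀ z, ip A z x = ip A z y) : x = y := by
  have h0 : ip A (x - y) (x - y) = 0 := by
    have := h (x - y)
    rw [← sub_eq_zero] at this
    simpa [ip] using this
  have : ‖x - y‖ ^ 2 = 0 := by rw [norm_sq_eq A, h0, norm_zero]
  exact sub_eq_zero.1 (norm_eq_zero.1 (by simpa using this))

lemma norm_op_smul_le (a : A) (x : E) : ‖op a • x‖ ≤ ‖a‖ * ‖x‖ := by
  have h : ‖op a • x‖ ^ 2 ≤ (‖a‖ * ‖x‖) ^ 2 := by
    rw [norm_sq_eq A, ip_op_smul_left, ip_op_smul_right, mul_pow, norm_sq_eq A x]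
    calc _ ≤ ‖star a‖ * (‖ip A x x‖ * ‖a‖) :=
          (norm_mul_le _ _).trans (by gcongr; exact norm_mul_le _ _)
      _ = _ := by rw [norm_star]; ring
  exact (pow_le_pow_iff_left₀ (norm_nonneg _) (by positivity) two_ne_zero).1 h

variable (E) in
/-- The adjointable operators on the Hilbert module `E`, as a subalgebra of the bounded ones. -/
def adjointableSubalgebra : Subalgebra ℂ (E →L[ℂ] E) where
  carrier := {T | ∃ S : E →L[ℂ] E, ∀ x y, ip A (T x) y = ip A x (S y)}
  mul_mem' := by
    rintro T₁ T₂ ⟨S₁, h₁⟩ ⟨S₂, h₂⟩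
    exact ⟨S₂ * S₁, fun x y => by simp [h₁, h₂]⟩
  add_mem' := by
    rintro T₁ T₂ ⟨S₁, h₁⟩ ⟨S₂, h₂⟩
    exact ⟨S₁ + S₂, fun x y => by simp [h₁, h₂, ip_add_left, ip_add_right]⟩
  algebraMap_mem' c := ⟨algebraMap ℂ _ (star c), fun x y => by
    simp [Algebra.algebraMap_eq_smul_one, ip_smul_left, ip_smul_right]⟩

variable (E) in
/-- `B(E)`: the algebra of adjointable operators on the Hilbert module `E`, with the operator
norm. -/
def Adjointable : Type _ := adjointableSubalgebra A E

variable {A}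

namespace Adjointable

instance : NormedRing (Adjointable A E) := inferInstanceAs (NormedRing (adjointableSubalgebra A E))

instance : NormedAlgebra ℂ (Adjointable A E) :=
  inferInstanceAs (NormedAlgebra ℂ (adjointableSubalgebra A E))

/-- The underlying bounded operator. -/
def toCLM (T : Adjointable A E) : E →L[ℂ] E := T.1

instance : CoeFun (Adjointable A E) fun _ => E → E := ⟨fun T => T.toCLM⟩

@[ext] lemma ext {S T : Adjointable A E} (h : ∀ x, S x = T x) : S = T :=
  Subtype.ext (ContinuousLinearMap.ext h)

lemma ext_ip {S T : Adjointable A E} (h : ∀ x y, ip A x (S y) = ip A x (T y)) : S = T :=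
  ext fun y => ext_ip_left A fun x => h x y

/-- The adjoint operator. -/
instance : Star (Adjointable A E) where
  star T := ⟨T.2.choose, T.1, fun x y => by
    rw [← star_ip, ← T.2.choose_spec, star_ip]⟩

lemma ip_apply_left (T : Adjointable A E) (x y : E) : ip A (T x) y = ip A x ((star T) y) :=
  T.2.choose_spec x y

lemma ip_apply_right (T : Adjointable A E) (x y : E) : ip A x (T y) = ip A ((star T) x) y := by
  rw [← star_ip, ip_apply_left, star_ip]

@[simp] lemma mul_apply (S T : Adjointable A E) (x : E) : (S * T) x = S (T x) := rfl
@[simp] lemma add_apply (S T : Adjointable A E) (x : E) : (S + T) x = S x + T x := rfl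
@[simp] lemma smul_apply (c : ℂ) (T : Adjointable A E) (x : E) : (c • T) x = c • T x := rfl
@[simp] lemma one_apply (x : E) : (1 : Adjointable A E) x = x := rfl
@[simp] lemma zero_apply (x : E) : (0 : Adjointable A E) x = 0 := rfl

instance : StarRing (Adjointable A E) where
  star_involutive T := ext_ip fun x y => by rw [← ip_apply_left, ← ip_apply_right]
  star_mul S T := ext_ip fun x y => by
    rw [← ip_apply_left, mul_apply, mul_apply, ip_apply_left, ip_apply_left]
  star_add S T := ext_ip fun x y => by
    rw [← ip_apply_left, add_apply, add_apply, ip_add_left, ip_add_right, ip_apply_left,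
      ip_apply_left]

instance : StarModule ℂ (Adjointable A E) where
  star_smul c T := ext_ip fun x y => by
    rw [← ip_apply_left, smul_apply, smul_apply, ip_smul_left, ip_smul_right, ip_apply_left]

lemma norm_apply_le (T : Adjointable A E) (x : E) : ‖T x‖ ≤ ‖T‖ * ‖x‖ :=
  T.toCLM.le_opNorm x

lemma norm_le (T : Adjointable A E) {C : ℝ} (hC : 0 ≤ C) (h : ∀ x, ‖T x‖ ≤ C * ‖x‖) : ‖T‖ ≤ C :=
  T.toCLM.opNorm_le_bound hC h

lemma norm_sq_apply_le (T : Adjointable A E) (x : E) : ‖T x‖ ^ 2 ≤ ‖star T * T‖ * ‖x‖ ^ 2 := by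
  rw [norm_sq_eq A, ip_apply_left]
  calc _ ≤ ‖x‖ * ‖(star T * T) x‖ := norm_ip_le A _ _
    _ ≤ ‖x‖ * (‖star T * T‖ * ‖x‖) := by gcongr; exact norm_apply_le _ _
    _ = _ := by ring

instance : CStarRing (Adjointable A E) where
  norm_mul_self_le T := by
    have h : ‖T‖ ≤ √‖star T * T‖ := norm_le T (Real.sqrt_nonneg _) fun x => by
      refine (pow_le_pow_iff_left₀ (norm_nonneg _) (by positivity) two_ne_zero).1 ?_
      rw [mul_pow, Real.sq_sqrt (norm_nonneg (star T * T))]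
      exact norm_sq_apply_le T x
    calc ‖T‖ * ‖T‖ ≤ √‖star T * T‖ * √‖star T * T‖ := by gcongr
      _ = _ := Real.mul_self_sqrt (norm_nonneg _)

lemma isClosed [CompleteSpace E] : IsClosed (adjointableSubalgebra A E : Set (E →L[ℂ] E)) := by
  refine isClosed_of_closure_subset fun T hT => ?_
  obtain ⟨u, hu, hlim⟩ := mem_closure_iff_seq_limit.1 hT
  let v : ℕ → Adjointable A E := fun n => ⟨u n, hu n⟩
  have hv : CauchySeq fun n => (star (v n)).toCLM := by
    have := hlim.cauchySeq
    rw [Metric.cauchySeq_iff] at this ⊢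
    intro ε hε
    obtain ⟨N, hN⟩ := this ε hε
    refine ⟨N, fun m hm n hn => ?_⟩
    have := hN m hm n hn
    rw [dist_eq_norm] at this ⊢
    have e : ‖star (v m) - star (v n)‖ = ‖v m - v n‖ := by rw [← star_sub, norm_star]
    exact lt_of_eq_of_lt e this
  obtain ⟨S, hS⟩ := cauchySeq_tendsto_of_complete hv
  refine ⟨S, fun x y => ?_⟩
  have h1 : Filter.Tendsto (fun n => ip A (u n x) y) Filter.atTop (nhds (ip A (T x) y)) :=
    ((continuous_ip A).tendsto (T x, y)).comp
      (((((ContinuousLinearMap.apply ℂ E x).continuous.tendsto T).comp hlim)).prodMk_nhds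
        tendsto_const_nhds)
  have h2 : Filter.Tendsto (fun n => ip A x ((star (v n)) y)) Filter.atTop
      (nhds (ip A x (S y))) :=
    ((continuous_ip A).tendsto (x, S y)).comp
      (tendsto_const_nhds.prodMk_nhds
        (((ContinuousLinearMap.apply ℂ E y).continuous.tendsto S).comp hS))
  exact tendsto_nhds_unique h1 (h2.congr fun n => (ip_apply_left (v n) x y).symm)

instance [CompleteSpace E] : CompleteSpace (Adjointable A E) :=
  (isClosed (A := A) (E := E)).completeSpace_coe

/-- The adjointable operators on a Hilbert module form a unital C⋆-algebra. -/
instance [CompleteSpace E] : CStarAlgebra (Adjointable A E) where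

end Adjointable

/-- The elementary compact operator `|x⟩⟨y| : z ↦ x ⟨y, z⟩`. -/
def rankOne (x y : E) : Adjointable A E :=
  have key (x y z w : E) : ip A (op (ip A y z) • x) w = ip A z (op (ip A x w) • y) := by
    rw [ip_op_smul_left, star_ip, ip_op_smul_right]
  let f (x y : E) : E →L[ℂ] E := LinearMap.mkContinuous
    { toFun := fun z => op (ip A y z) • x
      map_add' := fun z w => by rw [ip_add_right, op_add, add_smul]
      map_smul' := fun c z => ext_ip_left A fun w => by
        simp only [ip_smul_right, ip_op_smul_right, RingHom.id_apply, mul_smul_comm] }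
    (‖y‖ * ‖x‖) (fun z => by
      calc _ ≤ ‖ip A y z‖ * ‖x‖ := norm_op_smul_le A _ _
        _ ≤ ‖y‖ * ‖z‖ * ‖x‖ := by gcongr; exact norm_ip_le A _ _
        _ = _ := by ring)
  ⟨f x y, f y x, fun z w => key x y z w⟩

@[simp] lemma rankOne_apply (x y z : E) : (rankOne x y : Adjointable A E) z = op (ip A y z) • x := rfl

variable (A E) in
/-- `K(E)`: the closed linear span of the elementary compact operators. -/
def Compacts : Submodule ℂ (Adjointable A E) :=
  (Submodule.span ℂ {T | ∃ x y : E, T = rankOne x y}).topologicalClosure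

end HilbertModules

section FockSpace

variable {A : Type*} [CStarAlgebra A] [PartialOrder A] [StarOrderedRing A]

/-- A selfadjoint `M` is of the form `B⋆ B` as soon as `N⋆ M N = -S⋆ S` forces `S = 0`. -/
lemma exists_eq_star_mul_self {R : Type*} [CStarAlgebra R] (M : R) (hM : star M = M)
    (h : ∀ N S : R, star N * M * N = -(star S * S) → S = 0) : ∃ B : R, M = star B * B := by
  let _ : PartialOrder R := CStarAlgebra.spectralOrder R
  have _ : StarOrderedRing R := CStarAlgebra.spectralOrderedRing R
  have hM' : IsSelfAdjoint M := hM
  have hN : 0 ≤ M⁻ := CFC.negPart_nonneg M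
  obtain ⟨S, hS⟩ := CStarAlgebra.nonneg_iff_eq_star_mul_self.1 hN
  have hNs : star M⁻ = M⁻ := hN.isSelfAdjoint
  have h1 : star M⁻ * M * M⁻ = - (star (S * M⁻) * (S * M⁻)) := by
    have e : star (S * M⁻) * (S * M⁻) = M⁻ * (star S * S) * M⁻ := by
      rw [star_mul, hNs]
      simp only [mul_assoc]
    rw [e, ← hS, hNs]
    conv_lhs => lhs; rhs; rw [← CFC.posPart_sub_negPart M hM']
    rw [mul_sub, CFC.negPart_mul_posPart, zero_sub, neg_mul]
  have h8 : M⁻ = 0 := by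
    refine (CStarRing.star_mul_self_eq_zero_iff _).1 ?_
    rw [hNs]
    conv_lhs => lhs; rw [hS]
    rw [mul_assoc, h _ _ h1, mul_zero]
  have h9 : 0 ≤ M := by
    have := CFC.posPart_sub_negPart M hM'
    rw [h8, sub_zero] at this
    rw [← this]
    exact CFC.posPart_nonneg M
  exact CStarAlgebra.nonneg_iff_eq_star_mul_self.1 h9

/-- A positive definite finite `A`-valued kernel is of the form `B⋆ B`. -/
lemma exists_factorization {ι : Type*} [Fintype ι] (C : ι → ι → A)
    (hs : ∀ i j, star (C i j) = C j i)
    (hp : ∀ a : ι → A, 0 ≤ ∑ i, ∑ j, star (a i) * C i j * a j) :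
    ∃ B : ι → ι → A, ∀ i j, C i j = ∑ k, star (B k i) * B k j := by
  classical
  let M : CStarMatrix ι ι A := CStarMatrix.ofMatrix (Matrix.of C)
  have hM : star M = M := by
    ext i j
    simp [M, CStarMatrix.star_apply, hs]
  obtain ⟨B, hB⟩ := exists_eq_star_mul_self M hM fun N S h => by
    ext k j
    have h3 : (star N * M * N) j j = ∑ i, ∑ k, star (N i j) * C i k * N k j := by
      rw [CStarMatrix.mul_apply, Finset.sum_comm]
      refine Finset.sum_congr rfl fun k _ => ?_
      rw [CStarMatrix.mul_apply, Finset.sum_mul]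
      rfl
    have h4 : (star S * S) j j = ∑ k, star (S k j) * S k j := by
      rw [CStarMatrix.mul_apply]
      rfl
    have h5 : 0 ≤ - ∑ k, star (S k j) * S k j := by
      rw [← h4, ← CStarMatrix.neg_apply, ← h, h3]
      exact hp fun i => N i j
    have h6 : ∑ k, star (S k j) * S k j = 0 :=
      le_antisymm (neg_nonneg.1 h5) (Finset.sum_nonneg fun k _ => star_mul_self_nonneg _)
    have h7 := (Finset.sum_eq_zero_iff_of_nonneg (fun k _ => star_mul_self_nonneg _)).1 h6 k
      (Finset.mem_univ k)
    simpa using (CStarRing.star_mul_self_eq_zero_iff _).1 h7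
  refine ⟨fun i j => B i j, fun i j => ?_⟩
  calc C i j = M i j := rfl
    _ = _ := by rw [hB, CStarMatrix.mul_apply]; rfl

variable {E : Type*} [NormedAddCommGroup E] [NormedSpace ℂ E] [CompleteSpace E] [Module Aᵐᵒᵖ E]
  [CStarModule Aᵐᵒᵖ E]

/-- `wordIp φ u c v` is the inner product `⟨u, c v⟩` of the elementary tensors
`u = e₁ ⊗ ⋯ ⊗ eₙ` and `c v = φ(c) f₁ ⊗ f₂ ⊗ ⋯ ⊗ fₘ`; the empty word is `1 ∈ A = E^{⊗ 0}`.
It is determined by `⟨e ⊗ u, f ⊗ v⟩ = ⟨u, ⟨e, f⟩ v⟩`, and words of different lengths are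
orthogonal. -/
def wordIp (φ : A →⋆ₐ[ℂ] Adjointable A E) : List E → A → List E → A
  | [], c, [] => c
  | e :: u, c, f :: v => wordIp φ u (ip A e (φ c f)) v
  | [], _, _ :: _ => 0
  | _ :: _, _, [] => 0

variable (φ : A →⋆ₐ[ℂ] Adjointable A E)

lemma wordIp_add (u : List E) (c d : A) (v : List E) :
    wordIp φ u (c + d) v = wordIp φ u c v + wordIp φ u d v := by
  induction u generalizing v c d with
  | nil => cases v <;> simp [wordIp]
  | cons e u ih => cases v <;> simp [wordIp, ip_add_right, ih]

lemma wordIp_zero (u v : List E) : wordIp φ u 0 v = 0 := by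
  have := wordIp_add φ u 0 0 v
  simpa using this

lemma wordIp_smul (u : List E) (z : ℂ) (c : A) (v : List E) :
    wordIp φ u (z • c) v = z • wordIp φ u c v := by
  induction u generalizing v c with
  | nil => cases v <;> simp [wordIp]
  | cons e u ih => cases v <;> simp [wordIp, ip_smul_right, ih]

lemma star_wordIp (u : List E) (c : A) (v : List E) :
    star (wordIp φ u c v) = wordIp φ v (star c) u := by
  induction u generalizing v c with
  | nil => cases v <;> simp [wordIp]
  | cons e u ih =>
    cases v with
    | nil => simp [wordIp]
    | cons f v =>
      rw [wordIp, wordIp, ih, star_ip, map_star, Adjointable.ip_apply_left]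

lemma wordIp_nonneg {ι : Type*} [Fintype ι] (n : ℕ) (u : ι → List E) (hu : ∀ i, (u i).length ≤ n)
    (C : ι → ι → A) (hs : ∀ i j, star (C i j) = C j i)
    (hp : ∀ a : ι → A, 0 ≤ ∑ i, ∑ j, star (a i) * C i j * a j) (a : ι → A) :
    0 ≤ ∑ i, ∑ j, star (a i) * wordIp φ (u i) (C i j) (u j) * a j := by
  classical
  induction n generalizing u C with
  | zero =>
    have : ∀ i, u i = [] := fun i => List.length_eq_zero_iff.1 (Nat.le_zero.1 (hu i))
    simpa [this, wordIp] using hp a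
  | succ n ih =>
    let e : ι → E := fun i => (u i).headD 0
    let D : ι → ι → A := fun i j => ip A (e i) (φ (C i j) (e j))
    obtain ⟨B, hB⟩ := exists_factorization C hs hp
    have hDs : ∀ i j, star (D i j) = D j i := fun i j => by
      simp only [D]
      rw [star_ip, Adjointable.ip_apply_left, ← map_star, hs]
    have hDp : ∀ a : ι → A, 0 ≤ ∑ i, ∑ j, star (a i) * D i j * a j := fun a => by
      have key : ∑ i, ∑ j, star (a i) * D i j * a j
          = ∑ k, ip A (∑ i, op (a i) • (φ (B k i)) (e i)) (∑ i, op (a i) • (φ (B k i)) (e i)) := by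
        have hD : ∀ i j, D i j = ∑ k, ip A (φ (B k i) (e i)) (φ (B k j) (e j)) := fun i j => by
          simp only [D, hB i j, Adjointable.ip_apply_left, ← map_star, ← Adjointable.mul_apply,
            ← map_mul]
          rw [← ip_sum_right, map_sum]
          congr 1
          exact map_sum (AddMonoidHom.mk' (fun T : Adjointable A E => T (e j)) fun _ _ => rfl) _ _
        simp only [ip_sum_left, ip_sum_right, ip_op_smul_left, ip_op_smul_right, hD,
          Finset.mul_sum, Finset.sum_mul]
        rw [Finset.sum_congr rfl fun i _ => Finset.sum_comm, Finset.sum_comm]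
        refine Finset.sum_congr rfl fun k _ => ?_
        rw [Finset.sum_comm]
      rw [key]
      exact Finset.sum_nonneg fun k _ => ip_self_nonneg A _
    let b : ι → A := fun i => if u i = [] then a i else 0
    have h1 := hp b
    have h2 := ih (fun i => (u i).tail) (fun i => by simpa using hu i) D hDs hDp
    have h3 : ∀ i j, star (a i) * wordIp φ (u i) (C i j) (u j) * a j
        = star (b i) * C i j * b j + star (a i) * wordIp φ (u i).tail (D i j) (u j).tail * a j := by
      intro i j
      simp only [b, D, e]
      cases hi : u i <;> cases hj : u j <;>
        simp [wordIp, wordIp_zero, ip_zero_left, ip_zero_right]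
    simp only [h3, Finset.sum_add_distrib]
    exact add_nonneg h1 h2

/-- The dense algebraic part of the Fock space: formal sums `∑ u ⊗ a_u` over words `u` in `E`, with
coefficients in `A`. The relations of the tensor products over `A` hold after passing to the
Hausdorff completion, because they hold for the inner products. -/
def PreFock (_ : A →⋆ₐ[ℂ] Adjointable A E) : Type _ := List E →₀ A

namespace PreFock

instance : AddCommGroup (PreFock φ) := inferInstanceAs (AddCommGroup (List E →₀ A))
instance : Module ℂ (PreFock φ) := inferInstanceAs (Module ℂ (List E →₀ A))
instance : Module Aᵐᵒᵖ (PreFock φ) := inferInstanceAs (Module Aᵐᵒᵖ (List E →₀ A))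

/-- The elementary tensor `u a`. -/
def word (u : List E) (a : A) : PreFock φ := Finsupp.single u a

variable {φ}

lemma induction {p : PreFock φ → Prop} (x : PreFock φ) (h0 : p 0)
    (hadd : ∀ x y, p x → p y → p (x + y)) (hw : ∀ u a, p (word φ u a)) : p x :=
  Finsupp.induction_linear (motive := p) x h0 hadd hw

/-- The linear map given on elementary tensors. -/
def lift {M : Type*} [AddCommGroup M] [Module ℂ M] (f : List E → A →ₗ[ℂ] M) : PreFock φ →ₗ[ℂ] M :=
  Finsupp.lsum ℂ f

@[simp] lemma lift_word {M : Type*} [AddCommGroup M] [Module ℂ M] (f : List E → A →ₗ[ℂ] M)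
    (u : List E) (a : A) : lift f (word φ u a) = f u a :=
  Finsupp.lsum_single ..

lemma smul_word (c : ℂ) (u : List E) (a : A) : c • word φ u a = word φ u (c • a) :=
  Finsupp.smul_single c u a

lemma op_smul_word (c : A) (u : List E) (a : A) : op c • word φ u a = word φ u (a * c) :=
  Finsupp.smul_single (op c) u a

lemma word_add (u : List E) (a b : A) : word φ u (a + b) = word φ u a + word φ u b :=
  Finsupp.single_add u a b

/-- The form `⟨x, p y⟩`, where `p = (c, k) ∈ A × B(E)` acts by `c` on `A = E^{⊗ 0}` and by `k ⊗ 1`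
on `E^{⊗ n} = E ⊗ E^{⊗ (n - 1)}`, `n ≥ 1`, given on words. -/
def wordForm (φ : A →⋆ₐ[ℂ] Adjointable A E) (p : A × Adjointable A E) : List E → List E → A
  | [], [] => p.1
  | e :: u, f :: v => wordIp φ u (ip A e (p.2 f)) v
  | [], _ :: _ => 0
  | _ :: _, [] => 0

/-- The sesquilinear extension of `wordForm` to finitely supported functions on words. -/
def finsuppForm (φ : A →⋆ₐ[ℂ] Adjointable A E) (p : A × Adjointable A E) (x y : List E →₀ A) : A :=
  x.sum fun u a => y.sum fun v b => star a * wordForm φ p u v * b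

/-- The sesquilinear extension of `wordForm` to the algebraic Fock space. -/
def form (p : A × Adjointable A E) (x y : PreFock φ) : A := finsuppForm φ p x y

lemma finsuppForm_add_left (p : A × Adjointable A E) (x y z : List E →₀ A) :
    finsuppForm φ p (x + y) z = finsuppForm φ p x z + finsuppForm φ p y z := by
  classical
  exact Finsupp.sum_add_index' (by simp) (by simp [add_mul, Finsupp.sum_add])

lemma finsuppForm_add_right (p : A × Adjointable A E) (x y z : List E →₀ A) :
    finsuppForm φ p x (y + z) = finsuppForm φ p x y + finsuppForm φ p x z := by
  classical
  simp only [finsuppForm]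
  rw [← Finsupp.sum_add]
  refine Finsupp.sum_congr fun u _ => ?_
  exact Finsupp.sum_add_index' (by simp) (by simp [mul_add])

lemma form_add_left (p : A × Adjointable A E) (x y z : PreFock φ) :
    form p (x + y) z = form p x z + form p y z := finsuppForm_add_left ..

lemma form_add_right (p : A × Adjointable A E) (x y z : PreFock φ) :
    form p x (y + z) = form p x y + form p x z := finsuppForm_add_right ..

lemma form_word (p : A × Adjointable A E) (u v : List E) (a b : A) :
    form p (word φ u a) (word φ v b) = star a * wordForm φ p u v * b := by
  simp only [form, word, finsuppForm]
  rw [Finsupp.sum_single_index (by simp), Finsupp.sum_single_index (by simp)]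

lemma form_zero_left (p : A × Adjointable A E) (y : PreFock φ) : form p 0 y = 0 := by
  simpa using form_add_left p 0 0 y

lemma form_zero_right (p : A × Adjointable A E) (y : PreFock φ) : form p y 0 = 0 := by
  simpa using form_add_right p y 0 0

/-- Two biadditive expressions agree if they agree on elementary tensors. -/
lemma induction₂ {f g : PreFock φ → PreFock φ → A}
    (f0 : ∀ y, f 0 y = 0) (f0' : ∀ x, f x 0 = 0)
    (fl : ∀ x y z, f (x + y) z = f x z + f y z) (fr : ∀ x y z, f x (y + z) = f x y + f x z)
    (g0 : ∀ y, g 0 y = 0) (g0' : ∀ x, g x 0 = 0)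
    (gl : ∀ x y z, g (x + y) z = g x z + g y z) (gr : ∀ x y z, g x (y + z) = g x y + g x z)
    (h : ∀ u a v b, f (word φ u a) (word φ v b) = g (word φ u a) (word φ v b)) (x y : PreFock φ) :
    f x y = g x y := by
  induction x using induction with
  | h0 => rw [f0, g0]
  | hadd x x' hx hx' => rw [fl, gl, hx, hx']
  | hw u a =>
    induction y using induction with
    | h0 => rw [f0', g0']
    | hadd y y' hy hy' => rw [fr, gr, hy, hy']
    | hw v b => exact h u a v b

lemma form_smul_right (p : A × Adjointable A E) (c : ℂ) (x y : PreFock φ) :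
    form p x (c • y) = c • form p x y := by
  refine induction₂ (f := fun x y => form p x (c • y)) (g := fun x y => c • form p x y)
    ?_ ?_ ?_ ?_ ?_ ?_ ?_ ?_ ?_ x y <;> intros <;>
    simp [form_zero_left, form_zero_right, form_add_left, form_add_right, smul_word, form_word]

lemma form_op_smul_right (p : A × Adjointable A E) (c : A) (x y : PreFock φ) :
    form p x (op c • y) = form p x y * c := by
  refine induction₂ (f := fun x y => form p x (op c • y)) (g := fun x y => form p x y * c)
    ?_ ?_ ?_ ?_ ?_ ?_ ?_ ?_ ?_ x y <;> intros <;>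
    simp [form_zero_left, form_zero_right, form_add_left, form_add_right, op_smul_word, form_word,
      add_mul, mul_assoc]

lemma star_wordForm (p : A × Adjointable A E) (u v : List E) :
    star (wordForm φ p u v) = wordForm φ (star p) v u := by
  cases u <;> cases v <;> simp [wordForm, star_wordIp, star_ip, Adjointable.ip_apply_left]

lemma star_form (p : A × Adjointable A E) (x y : PreFock φ) :
    star (form p x y) = form (star p) y x := by
  refine induction₂ (f := fun x y => star (form p x y)) (g := fun x y => form (star p) y x)
    ?_ ?_ ?_ ?_ ?_ ?_ ?_ ?_ ?_ x y <;> intros <;>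
    simp [form_zero_left, form_zero_right, form_add_left, form_add_right, form_word,
      star_wordForm, mul_assoc]

lemma wordForm_add (p q : A × Adjointable A E) (u v : List E) :
    wordForm φ (p + q) u v = wordForm φ p u v + wordForm φ q u v := by
  cases u <;> cases v <;> simp [wordForm, ip_add_right, wordIp_add]

lemma form_add (p q : A × Adjointable A E) (x y : PreFock φ) :
    form (p + q) x y = form p x y + form q x y := by
  refine induction₂ (f := fun x y => form (p + q) x y) (g := fun x y => form p x y + form q x y)
    ?_ ?_ ?_ ?_ ?_ ?_ ?_ ?_ ?_ x y <;> intros <;>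
    simp [form_zero_left, form_zero_right, form_add_left, form_add_right, form_word,
      wordForm_add, mul_add, add_mul] <;> abel

lemma wordForm_smul (c : ℂ) (p : A × Adjointable A E) (u v : List E) :
    wordForm φ (c • p) u v = c • wordForm φ p u v := by
  cases u <;> cases v <;> simp [wordForm, ip_smul_right, wordIp_smul]

lemma form_smul (c : ℂ) (p : A × Adjointable A E) (x y : PreFock φ) :
    form (c • p) x y = c • form p x y := by
  refine induction₂ (f := fun x y => form (c • p) x y) (g := fun x y => c • form p x y)
    ?_ ?_ ?_ ?_ ?_ ?_ ?_ ?_ ?_ x y <;> intros <;>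
    simp [form_zero_left, form_zero_right, form_add_left, form_add_right, form_word,
      wordForm_smul]

lemma wordForm_one (u v : List E) : wordForm φ 1 u v = wordIp φ u 1 v := by
  cases u <;> cases v <;> simp [wordForm, wordIp]

lemma finsuppForm_one_self_nonneg (x : List E →₀ A) : 0 ≤ finsuppForm φ 1 x x := by
  classical
  have h := wordIp_nonneg φ (ι := x.support)
    (x.support.sup List.length) (fun i => i.1)
    (fun i => Finset.le_sup (f := List.length) i.2) (fun _ _ => 1) (by simp) (fun a => by
      have : ∑ i, ∑ j, star (a i) * 1 * a j = star (∑ i, a i) * ∑ j, a j := by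
        simp [Finset.sum_mul_sum]
      rw [this]
      exact star_mul_self_nonneg _) (fun i => x i.1)
  have e : finsuppForm φ 1 x x = ∑ i : x.support, ∑ j : x.support,
      star (x i.1) * wordIp φ i.1 1 j.1 * x j.1 := by
    simp only [finsuppForm, Finsupp.sum, wordForm_one]
    rw [← Finset.sum_coe_sort]
    refine Finset.sum_congr rfl fun i _ => ?_
    rw [← Finset.sum_coe_sort]
  rw [e]
  exact h

lemma form_one_self_nonneg (x : PreFock φ) : 0 ≤ form 1 x x := finsuppForm_one_self_nonneg x

end PreFock
end FockSpace

section FockSpace2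

variable {A : Type*} [CStarAlgebra A] [PartialOrder A] [StarOrderedRing A]
variable {E : Type*} [NormedAddCommGroup E] [NormedSpace ℂ E] [CompleteSpace E] [Module Aᵐᵒᵖ E]
  [CStarModule Aᵐᵒᵖ E]
variable {φ : A →⋆ₐ[ℂ] Adjointable A E}

namespace PreFock

lemma form_smul_left (p : A × Adjointable A E) (c : ℂ) (x y : PreFock φ) :
    form p (c • x) y = star c • form p x y := by
  rw [← star_star (form p (c • x) y), star_form, form_smul_right, star_smul, star_form, star_star]

lemma form_op_smul_left (p : A × Adjointable A E) (c : A) (x y : PreFock φ) :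
    form p (op c • x) y = star c * form p x y := by
  rw [← star_star (form p (op c • x) y), star_form, form_op_smul_right, star_mul, star_form,
    star_star]

lemma form_sub_left (p : A × Adjointable A E) (x y z : PreFock φ) :
    form p (x - y) z = form p x z - form p y z := by
  rw [eq_sub_iff_add_eq, ← form_add_left, sub_add_cancel]

lemma form_sub_right (p : A × Adjointable A E) (x y z : PreFock φ) :
    form p x (y - z) = form p x y - form p x z := by
  rw [eq_sub_iff_add_eq, ← form_add_right, sub_add_cancel]

lemma star_form_one (x y : PreFock φ) : star (form 1 x y) = form 1 y x := by
  rw [star_form, star_one]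

lemma norm_form_sq_le (x y : PreFock φ) :
    ‖form 1 x y‖ ^ 2 ≤ ‖form 1 x x‖ * ‖form 1 y y‖ := by
  have key : ∀ P : ℝ, 0 < P → ‖form 1 x x‖ ≤ P → ‖form 1 x y‖ ^ 2 ≤ P * ‖form 1 y y‖ := by
    intro P hP hxP
    set r := form 1 x y with hr
    have h1 : 0 ≤ star r * form 1 x x * r - P • (star r * r) - P • (star r * r)
        + (P * P) • form 1 y y := by
      have := form_one_self_nonneg (op r • x - (P : ℂ) • y)
      rw [form_sub_left, form_sub_right, form_sub_right, form_op_smul_left, form_op_smul_left,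
        form_smul_left, form_smul_left, form_op_smul_right, form_op_smul_right, form_smul_right,
        form_smul_right, ← hr, ← star_form_one x y, ← hr] at this
      convert this using 1
      simp only [Complex.star_def, Complex.conj_ofReal, Complex.coe_smul, mul_smul_comm, mul_smul,
        mul_assoc]
      abel
    have h2 : star r * form 1 x x * r ≤ P • (star r * r) := by
      have hsa : IsSelfAdjoint (form 1 x x) := star_form_one x x
      refine (CStarAlgebra.star_left_conjugate_le_norm_smul hsa).trans ?_
      exact smul_le_smul_of_nonneg_right hxP (star_mul_self_nonneg r)
    have h3 : P • (star r * r) ≤ (P * P) • form 1 y y := by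
      have h4 : star r * form 1 x x * r - P • (star r * r) ≤ 0 := sub_nonpos.2 h2
      have h5 : 0 ≤ (0 : A) - P • (star r * r) + (P * P) • form 1 y y :=
        h1.trans (by gcongr)
      rw [zero_sub, neg_add_eq_sub] at h5
      exact sub_nonneg.1 h5
    have h6 : ‖P • (star r * r)‖ ≤ ‖(P * P) • form 1 y y‖ :=
      CStarAlgebra.norm_le_norm_of_nonneg_of_le
        (smul_nonneg hP.le (star_mul_self_nonneg r)) h3
    rw [norm_smul, norm_smul, CStarRing.norm_star_mul_self, Real.norm_of_nonneg hP.le,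
      Real.norm_of_nonneg (mul_nonneg hP.le hP.le), mul_assoc] at h6
    have := le_of_mul_le_mul_left h6 hP
    rwa [sq]
  refine le_of_forall_pos_le_add fun ε hε => ?_
  have hd : 0 < ε / (‖form 1 y y‖ + 1) := by positivity
  refine (key (‖form 1 x x‖ + ε / (‖form 1 y y‖ + 1)) (by positivity) (by linarith)).trans ?_
  rw [add_mul]
  gcongr
  rw [div_mul_eq_mul_div, div_le_iff₀ (by positivity)]
  nlinarith [norm_nonneg (form 1 y y)]

instance : Norm (PreFock φ) := ⟨fun x => √‖form 1 x x‖⟩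

lemma norm_def (x : PreFock φ) : ‖x‖ = √‖form 1 x x‖ := rfl

lemma norm_form_one_self (x : PreFock φ) : ‖form 1 x x‖ = ‖x‖ ^ 2 :=
  (Real.sq_sqrt (norm_nonneg _)).symm

lemma norm_form_le (x y : PreFock φ) : ‖form 1 x y‖ ≤ ‖x‖ * ‖y‖ := by
  refine (pow_le_pow_iff_left₀ (norm_nonneg _)
    (mul_nonneg (Real.sqrt_nonneg _) (Real.sqrt_nonneg _)) two_ne_zero).1 ?_
  rw [mul_pow]
  exact (norm_form_sq_le x y).trans_eq (by
    rw [Real.sq_sqrt (norm_nonneg _), Real.sq_sqrt (norm_nonneg _)])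

lemma core : SeminormedSpace.Core ℂ (PreFock φ) where
  norm_nonneg x := Real.sqrt_nonneg _
  norm_smul c x := by
    rw [norm_def, norm_def, form_smul_left, form_smul_right, norm_smul, norm_smul, norm_star,
      ← mul_assoc, Real.sqrt_mul (by positivity), Real.sqrt_mul_self (norm_nonneg c)]
  norm_triangle x y := by
    have hx : 0 ≤ ‖x‖ := Real.sqrt_nonneg _
    have hy : 0 ≤ ‖y‖ := Real.sqrt_nonneg _
    rw [norm_def (x + y)]
    refine Real.sqrt_le_iff.2 ⟨add_nonneg hx hy, ?_⟩
    rw [form_add_left, form_add_right, form_add_right]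
    calc _ ≤ (‖form 1 x x‖ + ‖form 1 x y‖) + (‖form 1 y x‖ + ‖form 1 y y‖) :=
          (norm_add_le _ _).trans (add_le_add (norm_add_le _ _) (norm_add_le _ _))
      _ ≤ (‖x‖ ^ 2 + ‖x‖ * ‖y‖) + (‖y‖ * ‖x‖ + ‖y‖ ^ 2) := by
          gcongr
          · exact (norm_form_one_self x).le
          · exact norm_form_le _ _
          · exact norm_form_le _ _
          · exact (norm_form_one_self y).le
      _ = _ := by ring

instance : SeminormedAddCommGroup (PreFock φ) := SeminormedAddCommGroup.ofCore core

instance : NormedSpace ℂ (PreFock φ) where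
  norm_smul_le c x := (core.norm_smul c x).le

instance : IsBoundedSMul Aᵐᵒᵖ (PreFock φ) := .of_norm_smul_le fun a x => by
  rw [norm_def (a • x)]
  refine Real.sqrt_le_iff.2 ⟨by positivity, ?_⟩
  obtain ⟨a⟩ := a
  change ‖form 1 (op a • x) (op a • x)‖ ≤ (‖a‖ * ‖x‖) ^ 2
  rw [form_op_smul_left, form_op_smul_right, mul_pow, ← norm_form_one_self]
  calc _ ≤ ‖star a‖ * (‖form 1 x x‖ * ‖a‖) :=
        (norm_mul_le _ _).trans (by gcongr; exact norm_mul_le _ _)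
    _ = _ := by rw [norm_star]; ring

instance : Inner Aᵐᵒᵖ (PreFock φ) := ⟨fun x y => op (form 1 x y)⟩

/-- The inner product as a biadditive map. -/
def formHom : PreFock φ →+ PreFock φ →+ Aᵐᵒᵖ :=
  AddMonoidHom.mk' (fun x => AddMonoidHom.mk' (fun y => op (form 1 x y)) fun y z => by
    rw [form_add_right, op_add]) fun x y => by
    ext z
    simp [form_add_left]

lemma continuous_form : Continuous fun p : PreFock φ × PreFock φ => form 1 p.1 p.2 := by
  let f : PreFock φ →ₗ⋆[ℂ] PreFock φ →ₗ[ℂ] A := LinearMap.mk₂'ₛₗ _ _ (form 1)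
    (form_add_left 1) (form_smul_left 1) (form_add_right 1) (form_smul_right 1)
  have h : ∀ x y, ‖f x y‖ ≤ 1 * ‖x‖ * ‖y‖ := fun x y => by
    rw [one_mul]
    exact norm_form_le x y
  exact ((f.mkContinuous₂ 1 h).continuous.comp continuous_fst).clm_apply continuous_snd

end PreFock

variable (φ) in
/-- The Fock space `A ⊕ E ⊕ E^{⊗ 2} ⊕ ⋯`, a right Hilbert `A`-module: the Hausdorff completion of
the span of elementary tensors. -/
def Fock : Type _ := UniformSpace.Completion (PreFock φ)

namespace Fock

open UniformSpace

instance : NormedAddCommGroup (Fock φ) := inferInstanceAs (NormedAddCommGroup (Completion (PreFock φ)))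
instance : NormedSpace ℂ (Fock φ) := inferInstanceAs (NormedSpace ℂ (Completion (PreFock φ)))
instance : CompleteSpace (Fock φ) := inferInstanceAs (CompleteSpace (Completion (PreFock φ)))
instance : Module Aᵐᵒᵖ (Fock φ) := inferInstanceAs (Module Aᵐᵒᵖ (Completion (PreFock φ)))
instance : ContinuousConstSMul Aᵐᵒᵖ (Fock φ) :=
  inferInstanceAs (ContinuousConstSMul Aᵐᵒᵖ (Completion (PreFock φ)))
instance : Inner Aᵐᵒᵖ (Fock φ) := inferInstanceAs (Inner Aᵐᵒᵖ (Completion (PreFock φ)))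

/-- The canonical map from the algebraic Fock space. -/
def mk : PreFock φ →L[ℂ] Fock φ := (Completion.toComplL : PreFock φ →L[ℂ] Completion (PreFock φ))

lemma mk_op_smul (a : Aᵐᵒᵖ) (x : PreFock φ) : mk (a • x) = a • mk x := Completion.coe_smul a x

lemma norm_mk (x : PreFock φ) : ‖mk x‖ = ‖x‖ := Completion.norm_coe x

lemma denseRange_mk : DenseRange (mk : PreFock φ → Fock φ) := Completion.denseRange_coe

lemma induction_on {p : Fock φ → Prop} (x : Fock φ) (hp : IsClosed {x | p x})
    (h : ∀ x : PreFock φ, p (mk x)) : p x := Completion.induction_on x hp h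

lemma inner_mk (x y : PreFock φ) : inner Aᵐᵒᵖ (mk x) (mk y) = op (PreFock.form 1 x y) :=
  (Completion.isDenseInducing_coe.prodMap Completion.isDenseInducing_coe).extend_eq
    (f := Function.uncurry (inner Aᵐᵒᵖ (E := PreFock φ)))
    (continuous_op.comp PreFock.continuous_form) (x, y)

lemma continuous_inner' : Continuous fun p : Fock φ × Fock φ => inner Aᵐᵒᵖ p.1 p.2 :=
  (Completion.isDenseInducing_toCompl (PreFock φ)).extend_Z_bilin
    (Completion.isDenseInducing_toCompl (PreFock φ)) (φ := PreFock.formHom)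
    (continuous_op.comp PreFock.continuous_form)

lemma continuous_inner {X : Type*} [TopologicalSpace X] {f g : X → Fock φ} (hf : Continuous f)
    (hg : Continuous g) : Continuous fun x => inner Aᵐᵒᵖ (f x) (g x) :=
  continuous_inner'.comp (hf.prodMk hg)

lemma norm_eq_sqrt (x : Fock φ) : ‖x‖ = √‖inner Aᵐᵒᵖ x x‖ := by
  induction x using induction_on with
  | hp =>
    refine isClosed_eq continuous_norm
      (Real.continuous_sqrt.comp (continuous_norm.comp (continuous_inner continuous_id continuous_id)))
  | h x => rw [inner_mk, norm_mk]; rfl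

/-- The Fock space is a right Hilbert `A`-module. -/
instance : CStarModule Aᵐᵒᵖ (Fock φ) where
  inner_add_right {x y z} := by
    induction x using induction_on with
    | hp =>
      refine isClosed_eq (continuous_inner continuous_id continuous_const)
        ((continuous_inner continuous_id continuous_const).add
          (continuous_inner continuous_id continuous_const))
    | h x =>
    induction y using induction_on with
    | hp =>
      refine isClosed_eq (continuous_inner continuous_const (continuous_id.add continuous_const))
        ((continuous_inner continuous_const continuous_id).add
          (continuous_inner continuous_const continuous_const))
    | h y =>
    induction z using induction_on with
    | hp =>
      refine isClosed_eq (continuous_inner continuous_const (continuous_const.add continuous_id))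
        ((continuous_inner continuous_const continuous_const).add
          (continuous_inner continuous_const continuous_id))
    | h z => rw [← map_add, inner_mk, inner_mk, inner_mk, PreFock.form_add_right, op_add]
  inner_self_nonneg {x} := by
    induction x using induction_on with
    | hp =>
      refine isClosed_le continuous_const (continuous_inner continuous_id continuous_id)
    | h x => rw [inner_mk]; exact PreFock.form_one_self_nonneg x
  inner_self {x} := by
    rw [← norm_eq_zero (a := x), norm_eq_sqrt, Real.sqrt_eq_zero (norm_nonneg _), norm_eq_zero]
  inner_op_smul_right {a x y} := by
    induction x using induction_on with
    | hp =>
      refine isClosed_eq (continuous_inner continuous_id continuous_const)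
        (continuous_const.mul (continuous_inner continuous_id continuous_const))
    | h x =>
    induction y using induction_on with
    | hp =>
      refine isClosed_eq (continuous_inner continuous_const (continuous_id.const_smul a))
        (continuous_const.mul (continuous_inner continuous_const continuous_id))
    | h y =>
      obtain ⟨a⟩ := a
      change inner Aᵐᵒᵖ (mk x) (op a • mk y) = op a * _
      rw [← mk_op_smul, inner_mk, inner_mk, PreFock.form_op_smul_right, op_mul]
  inner_smul_right_complex {c x y} := by
    induction x using induction_on with
    | hp =>
      refine isClosed_eq (continuous_inner continuous_id continuous_const)
        ((continuous_inner continuous_id continuous_const).const_smul c)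
    | h x =>
    induction y using induction_on with
    | hp =>
      refine isClosed_eq (continuous_inner continuous_const (continuous_id.const_smul c))
        ((continuous_inner continuous_const continuous_id).const_smul c)
    | h y => rw [← map_smul, inner_mk, inner_mk, PreFock.form_smul_right, op_smul]
  star_inner x y := by
    induction x using induction_on with
    | hp =>
      refine isClosed_eq (continuous_star.comp (continuous_inner continuous_id continuous_const))
        (continuous_inner continuous_const continuous_id)
    | h x =>
    induction y using induction_on with
    | hp =>
      refine isClosed_eq (continuous_star.comp (continuous_inner continuous_const continuous_id))
        (continuous_inner continuous_id continuous_const)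
    | h y => rw [inner_mk, inner_mk, ← op_star, PreFock.star_form_one]
  norm_eq_sqrt_norm_inner_self x := norm_eq_sqrt x

lemma ip_mk (x y : PreFock φ) : ip A (mk x) (mk y) = PreFock.form 1 x y := by
  rw [ip, inner_mk, unop_op]

/-- An operator on the Fock space is determined by its matrix coefficients. -/
lemma ext_form {S T : Adjointable A (Fock φ)}
    (h : ∀ x y : PreFock φ, ip A (mk x) (S (mk y)) = ip A (mk x) (T (mk y))) : S = T := by
  refine Adjointable.ext_ip fun x y => ?_
  induction x using induction_on with
  | hp =>
    refine isClosed_eq ((continuous_ip A).comp (continuous_id.prodMk continuous_const))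
      ((continuous_ip A).comp (continuous_id.prodMk continuous_const))
  | h x =>
  induction y using induction_on with
  | hp =>
    refine isClosed_eq
      ((continuous_ip A).comp (continuous_const.prodMk S.toCLM.continuous))
      ((continuous_ip A).comp (continuous_const.prodMk T.toCLM.continuous))
  | h y => exact h x y

/-- The extension to the Fock space of a bounded operator `T` on the algebraic Fock space which
has the adjoint `S` there. -/
def extend (T S : PreFock φ →ₗ[ℂ] PreFock φ)
    (hTS : ∀ x y, PreFock.form 1 (T x) y = PreFock.form 1 x (S y))
    (hT : ∃ C, ∀ x, ‖T x‖ ≤ C * ‖x‖) : Adjointable A (Fock φ) :=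
  have hS : ∃ C, ∀ x, ‖S x‖ ≤ C * ‖x‖ := by
    obtain ⟨C, hC⟩ := hT
    refine ⟨C, fun x => ?_⟩
    have h : ‖S x‖ * ‖S x‖ ≤ (C * ‖x‖) * ‖S x‖ := by
      rw [← sq, ← PreFock.norm_form_one_self, ← hTS]
      calc _ ≤ ‖T (S x)‖ * ‖x‖ := PreFock.norm_form_le _ _
        _ ≤ C * ‖S x‖ * ‖x‖ := by gcongr; exact hC _
        _ = _ := by ring
    rcases (norm_nonneg (S x)).eq_or_lt with h0 | h0
    · rw [← h0]
      exact (norm_nonneg _).trans (hC x)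
    · exact le_of_mul_le_mul_right h h0
  let T' : Fock φ →L[ℂ] Fock φ := (T.mkContinuousOfExistsBound hT).completion
  let S' : Fock φ →L[ℂ] Fock φ := (S.mkContinuousOfExistsBound hS).completion
  have hT' : ∀ x, T' (mk x) = mk (T x) := fun x =>
    ContinuousLinearMap.completion_apply_coe (T.mkContinuousOfExistsBound hT) x
  have hS' : ∀ x, S' (mk x) = mk (S x) := fun x =>
    ContinuousLinearMap.completion_apply_coe (S.mkContinuousOfExistsBound hS) x
  ⟨T', S', fun x y => by
    induction x using induction_on with
    | hp =>
      refine isClosed_eq ((continuous_ip A).comp (T'.continuous.prodMk continuous_const))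
        ((continuous_ip A).comp (continuous_id.prodMk continuous_const))
    | h x =>
    induction y using induction_on with
    | hp =>
      refine isClosed_eq ((continuous_ip A).comp (continuous_const.prodMk continuous_id))
        ((continuous_ip A).comp (continuous_const.prodMk S'.continuous))
    | h y => rw [hT', hS', ip_mk, ip_mk, hTS]⟩

lemma extend_mk (T S : PreFock φ →ₗ[ℂ] PreFock φ)
    (hTS : ∀ x y, PreFock.form 1 (T x) y = PreFock.form 1 x (S y))
    (hT : ∃ C, ∀ x, ‖T x‖ ≤ C * ‖x‖) (x : PreFock φ) :
    (extend T S hTS hT) (mk x) = mk (T x) :=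
  ContinuousLinearMap.completion_apply_coe (T.mkContinuousOfExistsBound hT) x

end Fock

end FockSpace2

section Operators

variable {A : Type*} [CStarAlgebra A] [PartialOrder A] [StarOrderedRing A]
variable {E : Type*} [NormedAddCommGroup E] [NormedSpace ℂ E] [CompleteSpace E] [Module Aᵐᵒᵖ E]
  [CStarModule Aᵐᵒᵖ E]
variable {φ : A →⋆ₐ[ℂ] Adjointable A E}

lemma exists_complement {R : Type*} [CStarAlgebra R] (p : R) :
    ∃ d : R, ((‖p‖ ^ 2 : ℝ) : ℂ) • (1 : R) = star p * p + star d * d := by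
  let _ : PartialOrder R := CStarAlgebra.spectralOrder R
  have _ : StarOrderedRing R := CStarAlgebra.spectralOrderedRing R
  have h : 0 ≤ algebraMap ℝ R (‖p‖ ^ 2) - star p * p := by
    rw [sub_nonneg]
    have := IsSelfAdjoint.le_algebraMap_norm_self (a := star p * p) (IsSelfAdjoint.star_mul_self p)
    rwa [CStarRing.norm_star_mul_self, ← sq] at this
  obtain ⟨d, hd⟩ := CStarAlgebra.nonneg_iff_eq_star_mul_self.1 h
  refine ⟨d, ?_⟩
  rw [← hd, Algebra.algebraMap_eq_smul_one, Complex.coe_smul, add_sub_cancel]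

namespace PreFock

variable (φ) in
/-- `a ↦ u a` as a linear map. -/
def wordₗ (u : List E) : A →ₗ[ℂ] PreFock φ where
  toFun := word φ u
  map_add' := word_add u
  map_smul' c a := (smul_word c u a).symm

@[simp] lemma wordₗ_apply (u : List E) (a : A) : wordₗ φ u a = word φ u a := rfl

/-- `p = (c, k)` acts by `c` on `A = E^{⊗ 0}` and by `k ⊗ 1` on `E^{⊗ n} = E ⊗ E^{⊗ (n - 1)}`. -/
def act (p : A × Adjointable A E) : PreFock φ →ₗ[ℂ] PreFock φ :=
  lift fun
    | [] => (wordₗ φ []).comp (LinearMap.mulLeft ℂ p.1)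
    | e :: u => wordₗ φ (p.2 e :: u)

lemma form_act (p q : A × Adjointable A E) (x y : PreFock φ) :
    form p x (act q y) = form (p * q) x y := by
  refine induction₂ (f := fun x y => form p x (act q y)) (g := fun x y => form (p * q) x y)
    ?_ ?_ ?_ ?_ ?_ ?_ ?_ ?_ ?_ x y <;> intros <;>
    try simp only [map_zero, map_add, form_zero_left, form_zero_right, form_add_left,
      form_add_right]
  rename_i u a v b
  cases u <;> cases v <;> simp [act, form_word, wordForm, mul_assoc]

lemma form_act_left (p q : A × Adjointable A E) (x y : PreFock φ) :
    form p (act q x) y = form (star q * p) x y := by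
  rw [← star_star (form p (act q x) y), star_form, form_act, star_form, star_mul, star_star]

lemma norm_act_le (p : A × Adjointable A E) (x : PreFock φ) : ‖act p x‖ ≤ ‖p‖ * ‖x‖ := by
  obtain ⟨d, hd⟩ := exists_complement p
  rw [norm_def (act p x)]
  refine Real.sqrt_le_iff.2 ⟨by positivity, ?_⟩
  rw [form_act, form_act_left, one_mul, mul_pow, ← norm_form_one_self]
  have h1 : ((‖p‖ ^ 2 : ℝ) : ℂ) • form 1 x x = form (star p * p) x x + form (star d * d) x x := by
    rw [← form_add, ← hd, form_smul]
  have h2 : 0 ≤ form (star p * p) x x := by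
    have := form_one_self_nonneg (act p x)
    rwa [form_act, form_act_left, one_mul] at this
  have h3 : 0 ≤ form (star d * d) x x := by
    have := form_one_self_nonneg (act d x)
    rwa [form_act, form_act_left, one_mul] at this
  calc _ ≤ ‖((‖p‖ ^ 2 : ℝ) : ℂ) • form 1 x x‖ :=
        CStarAlgebra.norm_le_norm_of_nonneg_of_le h2 (by rw [h1]; exact le_add_of_nonneg_right h3)
    _ = _ := by rw [norm_smul, Complex.norm_real, Real.norm_of_nonneg (by positivity)]

/-- The creation operator `u a ↦ (e ⊗ u) a`. -/
def create (e : E) : PreFock φ →ₗ[ℂ] PreFock φ := lift fun u => wordₗ φ (e :: u)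

/-- The annihilation operator, `0` on `A` and `(f ⊗ u) a ↦ ⟨e, f⟩ u a`. -/
def annihilate (e : E) : PreFock φ →ₗ[ℂ] PreFock φ :=
  lift fun
    | [] => 0
    | f :: u => (act (ip A e f, φ (ip A e f))).comp (wordₗ φ u)

lemma form_create_create (e f : E) (x y : PreFock φ) :
    form 1 (create e x) (create f y) = form (ip A e f, φ (ip A e f)) x y := by
  refine induction₂ (f := fun x y => form 1 (create e x) (create f y))
    (g := fun x y => form (ip A e f, φ (ip A e f)) x y)
    ?_ ?_ ?_ ?_ ?_ ?_ ?_ ?_ ?_ x y <;> intros <;>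
    try simp only [map_zero, map_add, form_zero_left, form_zero_right, form_add_left,
      form_add_right]
  rename_i u a v b
  cases u <;> cases v <;> simp [create, form_word, wordForm, wordIp]

lemma form_create (e : E) (x y : PreFock φ) :
    form 1 (create e x) y = form 1 x (annihilate e y) := by
  refine induction₂ (f := fun x y => form 1 (create e x) y)
    (g := fun x y => form 1 x (annihilate e y))
    ?_ ?_ ?_ ?_ ?_ ?_ ?_ ?_ ?_ x y <;> intros <;>
    try simp only [map_zero, map_add, form_zero_left, form_zero_right, form_add_left,
      form_add_right]
  rename_i u a v b
  cases v with
  | nil => simp [create, annihilate, form_word, wordForm, form_zero_right]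
  | cons f v =>
    have h : word φ (f :: v) b = create f (word φ v b) := by simp [create]
    rw [h, form_create_create, ← one_mul (ip A e f, φ (ip A e f)), ← form_act, ← h]
    simp [annihilate]

lemma norm_create_le (e : E) : ∃ C, ∀ x : PreFock φ, ‖create e x‖ ≤ C * ‖x‖ := by
  obtain ⟨d, hd⟩ := CStarAlgebra.nonneg_iff_eq_star_mul_self.1 (ip_self_nonneg A e)
  refine ⟨‖((d, φ d) : A × Adjointable A E)‖, fun x => ?_⟩
  have h : ‖create e x‖ = ‖act ((d, φ d) : A × Adjointable A E) x‖ := by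
    have h' : ((star d * d, φ (star d * d)) : A × Adjointable A E) = star (d, φ d) * (d, φ d) :=
      Prod.ext rfl (by rw [map_mul, map_star]; rfl)
    rw [norm_def, norm_def, form_create_create, form_act, form_act_left, hd, one_mul, h']
  rw [h]
  exact norm_act_le _ x

/-- The operator that scales `E^{⊗ n}` by `z ^ n`. -/
def scale (z : ℂ) : PreFock φ →ₗ[ℂ] PreFock φ := lift fun u => z ^ u.length • wordₗ φ u

lemma scale_word (z : ℂ) (u : List E) (a : A) :
    scale z (word φ u a) = z ^ u.length • word φ u a := by simp [scale]

lemma wordIp_eq_zero (u : List E) (c : A) (v : List E) (h : u.length ≠ v.length) :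
    wordIp φ u c v = 0 := by
  induction u generalizing c v with
  | nil => cases v <;> simp_all [wordIp]
  | cons e u ih =>
    cases v with
    | nil => rfl
    | cons f v => exact ih _ _ (by simpa using h)

lemma form_scale (z : ℂ) (x y : PreFock φ) : form 1 (scale z x) y = form 1 x (scale (star z) y) := by
  refine induction₂ (f := fun x y => form 1 (scale z x) y)
    (g := fun x y => form 1 x (scale (star z) y))
    ?_ ?_ ?_ ?_ ?_ ?_ ?_ ?_ ?_ x y <;> intros <;>
    try simp only [map_zero, map_add, form_zero_left, form_zero_right, form_add_left,
      form_add_right]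
  rename_i u a v b
  rw [scale_word, scale_word, form_smul_left, form_smul_right, star_pow, form_word]
  by_cases h : u.length = v.length
  · rw [h]
  · rw [wordForm_one, wordIp_eq_zero u 1 v h]
    simp

lemma linearMap_ext {f g : PreFock φ →ₗ[ℂ] PreFock φ} (h : ∀ u a, f (word φ u a) = g (word φ u a)) :
    f = g := by
  ext x
  induction x using induction with
  | h0 => simp
  | hadd x y hx hy => rw [map_add, map_add, hx, hy]
  | hw u a => exact h u a

lemma scale_scale (z w : ℂ) (x : PreFock φ) : scale z (scale w x) = scale (z * w) x := by
  have h : (scale z).comp (scale w) = scale (φ := φ) (z * w) := linearMap_ext fun u a => by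
    rw [LinearMap.comp_apply, scale_word, map_smul, scale_word, scale_word, smul_smul, mul_pow,
      mul_comm]
  rw [← h, LinearMap.comp_apply]

lemma scale_one (x : PreFock φ) : scale 1 x = x :=
  LinearMap.congr_fun (g := LinearMap.id) (linearMap_ext fun u a => by simp [scale_word]) x

lemma scale_create (z : ℂ) (e : E) (x : PreFock φ) :
    scale z (create e x) = z • create e (scale z x) :=
  LinearMap.congr_fun (f := (scale z).comp (create e)) (g := z • (create e).comp (scale z))
    (linearMap_ext fun u a => by simp [scale_word, create, smul_smul, pow_succ, mul_comm]) x

lemma scale_act (z : ℂ) (p : A × Adjointable A E) (x : PreFock φ) :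
    scale z (act p x) = act p (scale z x) :=
  LinearMap.congr_fun (f := (scale z).comp (act p)) (g := (act p).comp (scale z))
    (linearMap_ext fun u a => by cases u <;> simp [scale_word, act]) x

lemma norm_scale (z : Circle) (x : PreFock φ) : ‖scale (z : ℂ) x‖ = ‖x‖ := by
  rw [norm_def, norm_def, form_scale, scale_scale]
  simp [← Complex.normSq_eq_conj_mul_self, scale_one]

end PreFock

open Fock PreFock

variable (φ) in
/-- The representation of `A × B(E)` on the Fock space in which `(c, k)` acts by `c` on
`A = E^{⊗ 0}` and by `k ⊗ 1` on `E^{⊗ n} = E ⊗ E^{⊗ (n - 1)}` for `n ≥ 1`. -/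
def fockOp (p : A × Adjointable A E) : Adjointable A (Fock φ) :=
  extend (act p) (act (star p)) (fun x y => by rw [form_act, form_act_left, mul_one, one_mul])
    ⟨‖p‖, norm_act_le p⟩

@[simp] lemma fockOp_mk (p : A × Adjointable A E) (x : PreFock φ) :
    fockOp φ p (mk x) = mk (act p x) := extend_mk ..

lemma ip_fockOp (p : A × Adjointable A E) (x y : PreFock φ) :
    ip A (mk x) (fockOp φ p (mk y)) = form p x y := by
  rw [fockOp_mk, ip_mk, form_act, one_mul]

variable (φ) in
/-- `fockOp` as a homomorphism of C⋆-algebras. -/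
def fockRep : A × Adjointable A E →⋆ₐ[ℂ] Adjointable A (Fock φ) where
  toFun := fockOp φ
  map_one' := ext_form fun x y => by rw [ip_fockOp, Adjointable.one_apply, ip_mk]
  map_mul' p q := ext_form fun x y => by
    rw [ip_fockOp, Adjointable.mul_apply, fockOp_mk, ip_fockOp, form_act]
  map_zero' := ext_form fun x y => by
    rw [ip_fockOp, Adjointable.zero_apply, ip_zero_right]
    simpa using form_add (0 : A × Adjointable A E) 0 x y
  map_add' p q := ext_form fun x y => by
    rw [Adjointable.add_apply, ip_add_right, ip_fockOp, ip_fockOp, ip_fockOp, form_add]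
  commutes' c := ext_form fun x y => by
    rw [ip_fockOp, Algebra.algebraMap_eq_smul_one, Algebra.algebraMap_eq_smul_one, form_smul,
      Adjointable.smul_apply, Adjointable.one_apply, ip_smul_right, ip_mk]
  map_star' p := ext_form fun x y => by
    rw [ip_fockOp, ← Adjointable.ip_apply_left, fockOp_mk, ip_mk, form_act_left, mul_one]

variable (φ) in
/-- The left action of `A` on the Fock space. -/
def leftMul : A →⋆ₐ[ℂ] Adjointable A (Fock φ) := (fockRep φ).comp ((StarAlgHom.id ℂ A).prod φ)

variable (φ) in
/-- `k ↦ k ⊗ 1` on `E ⊗ E^{⊗ n}`, `n ≥ 0`, and `0` on `A`. On `K(E)` this is the canonical map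
`ψ₁`, the one with `ψ₁(|e⟩⟨f|) = e f⋆`, see `psi_rankOne`. -/
def psi (k : Adjointable A E) : Adjointable A (Fock φ) := fockRep φ (0, k)

variable (φ) in
/-- The creation operator of `e ∈ E` on the Fock space. -/
def creation (e : E) : Adjointable A (Fock φ) :=
  extend (create e) (annihilate e) (form_create e) (norm_create_le e)

@[simp] lemma creation_mk (e : E) (x : PreFock φ) : creation φ e (mk x) = mk (create e x) :=
  extend_mk ..

lemma star_creation_mk (e : E) (x : PreFock φ) :
    (star (creation φ e)) (mk x) = mk (annihilate e x) :=
  ext_ip_left A fun z => by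
    rw [← Adjointable.ip_apply_left]
    induction z using induction_on with
    | hp =>
      exact isClosed_eq
        ((continuous_ip A).comp ((creation φ e).toCLM.continuous.prodMk continuous_const))
        ((continuous_ip A).comp (continuous_id.prodMk continuous_const))
    | h z => rw [creation_mk, ip_mk, ip_mk, form_create]

lemma psi_rankOne (e f : E) :
    psi φ (rankOne e f) = creation φ e * star (creation φ f) := ext_form fun x y => by
  change ip A (mk x) (fockOp φ (0, rankOne e f) (mk y)) = _
  rw [ip_fockOp, Adjointable.mul_apply, Adjointable.ip_apply_right, star_creation_mk,
    star_creation_mk, ip_mk]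
  refine induction₂ (f := fun x y => form ((0, rankOne e f) : A × Adjointable A E) x y)
    (g := fun x y => form 1 (annihilate e x) (annihilate f y))
    ?_ ?_ ?_ ?_ ?_ ?_ ?_ ?_ ?_ x y <;> intros <;>
    try simp only [map_zero, map_add, form_zero_left, form_zero_right, form_add_left,
      form_add_right]
  rename_i u a v b
  cases u with
  | nil => cases v <;> simp [annihilate, form_word, wordForm, form_zero_left]
  | cons e' u =>
    cases v with
    | nil => simp [annihilate, form_word, wordForm, form_zero_right]
    | cons f' v =>
      simp only [annihilate, lift_word, LinearMap.comp_apply, wordₗ_apply, form_act, form_act_left,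
        form_word, wordForm, rankOne_apply]
      congr 2
      cases u <;> cases v <;>
        simp [wordIp, ip_op_smul_right, star_ip, ← map_star]

variable (φ) in
/-- The unitary that scales `E^{⊗ n}` by `z ^ n`. -/
def fockScale (z : Circle) : Adjointable A (Fock φ) :=
  extend (scale (z : ℂ)) (scale (star (z : ℂ))) (form_scale _)
    ⟨1, fun x => by rw [one_mul, norm_scale]⟩

@[simp] lemma fockScale_mk (z : Circle) (x : PreFock φ) :
    fockScale φ z (mk x) = mk (scale (z : ℂ) x) := extend_mk ..

lemma fockScale_mul (z w : Circle) : fockScale φ (z * w) = fockScale φ z * fockScale φ w :=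
  ext_form fun x y => by simp [scale_scale]

lemma fockScale_one : fockScale φ 1 = 1 := ext_form fun x y => by simp [scale_one]

lemma star_fockScale (z : Circle) : star (fockScale φ z) = fockScale φ z⁻¹ :=
  ext_form fun x y => by
    rw [← Adjointable.ip_apply_left, fockScale_mk, fockScale_mk, ip_mk, ip_mk, form_scale,
      Circle.coe_inv_eq_conj]
    rfl

lemma fockScale_conj_creation (z : Circle) (e : E) :
    fockScale φ z * creation φ e * star (fockScale φ z) = (z : ℂ) • creation φ e := by
  have h : fockScale φ z * creation φ e = (z : ℂ) • (creation φ e * fockScale φ z) :=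
    ext_form fun x y => by simp [scale_create]
  rw [h, star_fockScale, smul_mul_assoc, mul_assoc, ← fockScale_mul, mul_inv_cancel, fockScale_one,
    mul_one]

lemma fockScale_conj_fockRep (z : Circle) (p : A × Adjointable A E) :
    fockScale φ z * fockRep φ p * star (fockScale φ z) = fockRep φ p := by
  have h : fockScale φ z * fockRep φ p = fockRep φ p * fockScale φ z :=
    ext_form fun x y => by
      change ip A (mk x) (fockScale φ z (fockOp φ p (mk y)))
        = ip A (mk x) (fockOp φ p (fockScale φ z (mk y)))
      simp [scale_act]
  rw [h, star_fockScale, mul_assoc, ← fockScale_mul, mul_inv_cancel, fockScale_one, mul_one]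

end Operators

section Quotients

variable {R : Type*} [CStarAlgebra R]

lemma continuous_starAlgHom {S : Type*} [CStarAlgebra S] (f : R →⋆ₐ[ℂ] S) : Continuous f :=
  AddMonoidHomClass.continuous_of_bound f 1 fun x => by
    rw [one_mul]
    exact NonUnitalStarAlgHom.norm_apply_le f x

lemma exists_approx (b : R) {ε : ℝ} (hε : 0 < ε) :
    ∃ c : R, ‖1 - star b * b * c‖ ≤ 1 ∧ ‖b * (1 - star b * b * c)‖ ≤ ε := by
  let _ : PartialOrder R := CStarAlgebra.spectralOrder R
  have _ : StarOrderedRing R := CStarAlgebra.spectralOrderedRing R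
  set h := star b * b with hh
  have hpos : 0 ≤ h := star_mul_self_nonneg b
  have hsa : IsSelfAdjoint h := hpos.isSelfAdjoint
  have hsp : ∀ t ∈ spectrum ℝ h, 0 ≤ t := fun t ht => spectrum_nonneg_of_nonneg hpos ht
  have hd : 0 < ε ^ 2 := by positivity
  have hne : ∀ t ∈ spectrum ℝ h, ε ^ 2 + t ≠ 0 := fun t ht => by
    have := hsp t ht
    positivity
  have hc : ContinuousOn (fun t : ℝ => (ε ^ 2 + t)⁻¹) (spectrum ℝ h) :=
    ContinuousOn.inv₀ (by fun_prop) hne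
  have hf : 1 - h * cfc (fun t : ℝ => (ε ^ 2 + t)⁻¹) h
      = cfc (fun t : ℝ => ε ^ 2 * (ε ^ 2 + t)⁻¹) h := by
    have h1 : h * cfc (fun t : ℝ => (ε ^ 2 + t)⁻¹) h = cfc (fun t : ℝ => t * (ε ^ 2 + t)⁻¹) h := by
      rw [cfc_mul (fun t : ℝ => t) _ h (by fun_prop) hc, cfc_id' ℝ h]
    have h2 : (1 : R) = cfc (fun _ : ℝ => (1 : ℝ)) h := by rw [cfc_const_one ℝ h]
    rw [h1, h2, ← cfc_sub _ _ h (by fun_prop) (by fun_prop)]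
    refine cfc_congr fun t ht => ?_
    have := hne t ht
    field_simp
    ring
  refine ⟨cfc (fun t : ℝ => (ε ^ 2 + t)⁻¹) h, ?_, ?_⟩
  · rw [hf]
    refine norm_cfc_le zero_le_one fun t ht => ?_
    have := hsp t ht
    rw [Real.norm_of_nonneg (by positivity), ← div_eq_mul_inv, div_le_one (by positivity)]
    linarith
  · rw [hf]
    refine (pow_le_pow_iff_left₀ (norm_nonneg _) hε.le two_ne_zero).1 ?_
    have hfc : ContinuousOn (fun t : ℝ => ε ^ 2 * (ε ^ 2 + t)⁻¹) (spectrum ℝ h) :=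
      continuousOn_const.mul hc
    have hstar : star (cfc (fun t : ℝ => ε ^ 2 * (ε ^ 2 + t)⁻¹) h)
        = cfc (fun t : ℝ => ε ^ 2 * (ε ^ 2 + t)⁻¹) h := cfc_predicate (R := ℝ) _ h
    rw [sq, ← CStarRing.norm_star_mul_self, star_mul, hstar, mul_assoc, ← mul_assoc (star b), ← hh]
    have h1 : h * cfc (fun t : ℝ => ε ^ 2 * (ε ^ 2 + t)⁻¹) h
        = cfc (fun t : ℝ => t * (ε ^ 2 * (ε ^ 2 + t)⁻¹)) h := by
      rw [cfc_mul (fun t : ℝ => t) _ h (by fun_prop) hfc, cfc_id' ℝ h]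
    rw [h1, ← cfc_mul _ _ h hfc (by fun_prop)]
    refine norm_cfc_le hd.le fun t ht => ?_
    have := hsp t ht
    rw [Real.norm_of_nonneg (by positivity)]
    have h2 : ε ^ 2 * (ε ^ 2 + t)⁻¹ * (t * (ε ^ 2 * (ε ^ 2 + t)⁻¹))
        = ε ^ 2 * ((ε ^ 2 * t) / (ε ^ 2 + t) ^ 2) := by
      field_simp
    rw [h2]
    refine mul_le_of_le_one_right hd.le ?_
    rw [div_le_one (by positivity)]
    nlinarith

lemma star_mem_of_isClosed (I : Ideal R) [I.IsTwoSided] (hI : IsClosed (I : Set R)) {b : R}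
    (hb : b ∈ I) : star b ∈ I := by
  have : star b ∈ closure (I : Set R) := by
    refine Metric.mem_closure_iff.2 fun ε hε => ?_
    obtain ⟨c, -, hc⟩ := exists_approx (star b) (half_pos hε)
    refine ⟨star b * (star (star b) * star b * c), ?_, ?_⟩
    · rw [star_star]
      exact I.mul_mem_left _ (I.mul_mem_right _ (I.mul_mem_right _ hb))
    · rw [dist_eq_norm]
      rw [mul_sub, mul_one] at hc
      linarith
  rwa [hI.closure_eq] at this

lemma quotient_norm_mul_le (I : Ideal R) [I.IsTwoSided] (x y : R ⧸ I) :
    ‖x * y‖ ≤ ‖x‖ * ‖y‖ := by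
  refine le_of_forall_pos_le_add fun ε hε => ?_
  have hc : Filter.Tendsto (fun t : ℝ => (‖x‖ + t) * (‖y‖ + t)) (nhdsWithin 0 (Set.Ioi 0))
      (nhds ((‖x‖ + 0) * (‖y‖ + 0))) := by
    refine Filter.Tendsto.mono_left (Continuous.tendsto ?_ 0) nhdsWithin_le_nhds
    fun_prop
  rw [add_zero, add_zero] at hc
  obtain ⟨t, ht, ht0⟩ := ((hc.eventually_lt_const (lt_add_of_pos_right _ hε)).and
    self_mem_nhdsWithin).exists
  obtain ⟨a, rfl, ha⟩ := Submodule.Quotient.norm_mk_lt x ht0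
  obtain ⟨b, rfl, hb⟩ := Submodule.Quotient.norm_mk_lt y ht0
  calc _ ≤ ‖a * b‖ := Submodule.Quotient.norm_mk_le I (a * b)
    _ ≤ ‖a‖ * ‖b‖ := norm_mul_le _ _
    _ ≤ _ := mul_le_mul ha.le hb.le (norm_nonneg _) (by positivity)
    _ ≤ _ := ht.le

/-- The quotient of a C⋆-algebra by a two-sided ideal, with the quotient norm. -/
def CStarQuotient (I : Ideal R) : Type _ := R ⧸ I

namespace CStarQuotient

variable (I : Ideal R) [I.IsTwoSided] [hI : IsClosed (I : Set R)]

instance : NormedRing (CStarQuotient I) :=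
  { Submodule.Quotient.normedAddCommGroup I (hS := hI), Ideal.Quotient.ring I with
    norm_mul_le := quotient_norm_mul_le I }

instance : CompleteSpace (CStarQuotient I) := Submodule.Quotient.completeSpace I

instance : Algebra ℂ (CStarQuotient I) := inferInstanceAs (Algebra ℂ (R ⧸ I))

/-- The quotient map. -/
def mk : R →+* CStarQuotient I := Ideal.Quotient.mk I

variable {I}

lemma mk_surjective : Function.Surjective (mk I) := Ideal.Quotient.mk_surjective

lemma mk_eq_mk_iff {x y : R} : mk I x = mk I y ↔ x - y ∈ I := Ideal.Quotient.eq

lemma norm_mk_le (x : R) : ‖mk I x‖ ≤ ‖x‖ := Submodule.Quotient.norm_mk_le I x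

lemma exists_norm_lt (x : CStarQuotient I) {ε : ℝ} (hε : 0 < ε) :
    ∃ m : R, mk I m = x ∧ ‖m‖ < ‖x‖ + ε := Submodule.Quotient.norm_mk_lt x hε

lemma mk_smul (c : ℂ) (x : R) : mk I (c • x) = c • mk I x := rfl

instance : NormedAlgebra ℂ (CStarQuotient I) where
  norm_smul_le c x := by
    refine le_of_forall_pos_le_add fun ε hε => ?_
    obtain ⟨m, rfl, hm⟩ := exists_norm_lt x (ε := ε / (‖c‖ + 1)) (by positivity)
    rw [← mk_smul]
    calc _ ≤ ‖c‖ * ‖m‖ := (norm_mk_le _).trans (norm_smul_le _ _)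
      _ ≤ ‖c‖ * (‖mk I m‖ + ε / (‖c‖ + 1)) := by gcongr
      _ = ‖c‖ * ‖mk I m‖ + (‖c‖ / (‖c‖ + 1)) * ε := by ring
      _ ≤ ‖c‖ * ‖mk I m‖ + 1 * ε := by
        gcongr
        rw [div_le_one (by positivity)]
        linarith
      _ = _ := by rw [one_mul]

instance : Star (CStarQuotient I) where
  star := Quotient.map' star fun x y h => by
    rw [Submodule.quotientRel_def] at h ⊢
    rw [← star_sub]
    exact star_mem_of_isClosed I hI h

lemma mk_star (x : R) : mk I (star x) = star (mk I x) := rfl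

instance : StarRing (CStarQuotient I) where
  star_involutive x := by
    obtain ⟨x, rfl⟩ := mk_surjective x
    rw [← mk_star, ← mk_star, star_star]
  star_mul x y := by
    obtain ⟨x, rfl⟩ := mk_surjective x
    obtain ⟨y, rfl⟩ := mk_surjective y
    rw [← map_mul, ← mk_star, ← mk_star, ← mk_star, star_mul, map_mul]
  star_add x y := by
    obtain ⟨x, rfl⟩ := mk_surjective x
    obtain ⟨y, rfl⟩ := mk_surjective y
    rw [← map_add, ← mk_star, ← mk_star, ← mk_star, star_add, map_add]

instance : StarModule ℂ (CStarQuotient I) where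
  star_smul c x := by
    obtain ⟨x, rfl⟩ := mk_surjective x
    rw [← mk_smul, ← mk_star, ← mk_star, star_smul, mk_smul]

instance : CStarRing (CStarQuotient I) where
  norm_mul_self_le x := by
    obtain ⟨x, rfl⟩ := mk_surjective x
    refine le_of_forall_pos_le_add fun ε hε => ?_
    rw [← mk_star, ← map_mul]
    obtain ⟨m, hm, hm'⟩ := exists_norm_lt (mk I (star x * x)) (half_pos hε)
    have hb : m - star x * x ∈ I := mk_eq_mk_iff.1 hm
    set b := m - star x * x
    obtain ⟨c, hc1, hc2⟩ := exists_approx b (half_pos hε)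
    set f := 1 - star b * b * c with hf
    have hxf : mk I x = mk I (x * f) := by
      rw [mk_eq_mk_iff]
      have : x - x * f = x * (star b * b * c) := by rw [hf, mul_sub, mul_one, sub_sub_cancel]
      rw [this]
      exact I.mul_mem_left _ (I.mul_mem_right _ (I.mul_mem_left _ hb))
    have h1 : star (x * f) * (x * f) = star f * m * f - star f * (b * f) := by
      simp only [b, star_mul, mul_sub, sub_mul, mul_assoc]
      abel
    calc ‖mk I x‖ * ‖mk I x‖ ≤ ‖x * f‖ * ‖x * f‖ := by
          rw [hxf]
          gcongr <;> exact norm_mk_le _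
      _ = ‖star f * m * f - star f * (b * f)‖ := by rw [← CStarRing.norm_star_mul_self, h1]
      _ ≤ ‖star f * m * f‖ + ‖star f * (b * f)‖ := norm_sub_le _ _
      _ ≤ ‖star f‖ * ‖m‖ * ‖f‖ + ‖star f‖ * ‖b * f‖ := by
          gcongr
          · exact (norm_mul_le _ _).trans (by gcongr; exact norm_mul_le _ _)
          · exact norm_mul_le _ _
      _ ≤ 1 * ‖m‖ * 1 + 1 * (ε / 2) := by
          rw [norm_star]
          gcongr
      _ ≤ _ := by linarith

/-- The quotient of a unital C⋆-algebra by a closed two-sided ideal is a C⋆-algebra. -/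
instance : CStarAlgebra (CStarQuotient I) where

end CStarQuotient

end Quotients

section Generic

variable {B : Type*} [CStarAlgebra B]

lemma smul_mem_starSubalgebra (S : StarSubalgebra ℂ B) (c : ℂ) {x : B} (hx : x ∈ S) : c • x ∈ S :=
  SMulMemClass.smul_mem c hx

lemma map_mem_closure_adjoin {s : Set B} (f : B ≃⋆ₐ[ℂ] B)
    (hf : ∀ x ∈ s, f x ∈ (StarAlgebra.adjoin ℂ s).topologicalClosure) {x : B}
    (hx : x ∈ (StarAlgebra.adjoin ℂ s).topologicalClosure) :
    f x ∈ (StarAlgebra.adjoin ℂ s).topologicalClosure := by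
  have h1 : (StarAlgebra.adjoin ℂ s).topologicalClosure
      ≤ (StarAlgebra.adjoin ℂ s).topologicalClosure.comap (f : B →⋆ₐ[ℂ] B) :=
    StarSubalgebra.topologicalClosure_minimal (StarAlgebra.adjoin_le hf)
      (IsClosed.preimage (continuous_starAlgHom (f : B →⋆ₐ[ℂ] B))
        (StarSubalgebra.isClosed_topologicalClosure _))
  exact h1 hx

end Generic

section Algebras

variable {A : Type*} [CStarAlgebra A] [PartialOrder A] [StarOrderedRing A]
variable {E : Type*} [NormedAddCommGroup E] [NormedSpace ℂ E] [CompleteSpace E] [Module Aᵐᵒᵖ E]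
  [CStarModule Aᵐᵒᵖ E]
variable (φ : A →⋆ₐ[ℂ] Adjointable A E)

/-- The C⋆-subalgebra of `B(F(E))` generated by the creation operators and by `A`. -/
def toeplitzSubalgebra : StarSubalgebra ℂ (Adjointable A (Fock φ)) :=
  (StarAlgebra.adjoin ℂ (Set.range (leftMul φ) ∪ Set.range (creation φ))).topologicalClosure

instance : IsClosed (toeplitzSubalgebra φ : Set (Adjointable A (Fock φ))) :=
  StarSubalgebra.isClosed_topologicalClosure _

/-- The Pimsner-Toeplitz algebra `𝒯_E`. -/
def Toeplitz : Type _ := toeplitzSubalgebra φ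

instance : CStarAlgebra (Toeplitz φ) := inferInstanceAs (CStarAlgebra (toeplitzSubalgebra φ))

/-- The inclusion of `𝒯_E` in the adjointable operators on the Fock space. -/
def Toeplitz.incl : Toeplitz φ →⋆ₐ[ℂ] Adjointable A (Fock φ) := (toeplitzSubalgebra φ).subtype

variable {φ} in
lemma Toeplitz.ext {x y : Toeplitz φ} (h : Toeplitz.incl φ x = Toeplitz.incl φ y) : x = y :=
  Subtype.ext h

lemma leftMul_mem (a : A) : leftMul φ a ∈ toeplitzSubalgebra φ :=
  StarSubalgebra.le_topologicalClosure _ (StarAlgebra.subset_adjoin _ _ (Or.inl ⟨a, rfl⟩))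

lemma creation_mem (e : E) : creation φ e ∈ toeplitzSubalgebra φ :=
  StarSubalgebra.le_topologicalClosure _ (StarAlgebra.subset_adjoin _ _ (Or.inr ⟨e, rfl⟩))

/-- The copy of `a ∈ A` in `𝒯_E`. -/
def Toeplitz.ofA (a : A) : Toeplitz φ := ⟨leftMul φ a, leftMul_mem φ a⟩

/-- The copy of `e ∈ E`, the creation operator, in `𝒯_E`. -/
def Toeplitz.ofE (e : E) : Toeplitz φ := ⟨creation φ e, creation_mem φ e⟩

/-- `psi` as a linear map. -/
def psiₗ : Adjointable A E →ₗ[ℂ] Adjointable A (Fock φ) :=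
  (fockRep φ).toAlgHom.toLinearMap.comp (LinearMap.inr ℂ A (Adjointable A E))

lemma continuous_psi : Continuous (psi φ) :=
  (continuous_starAlgHom (fockRep φ)).comp (continuous_const.prodMk continuous_id)

lemma psi_mem {k : Adjointable A E} (hk : k ∈ Compacts A E) : psi φ k ∈ toeplitzSubalgebra φ := by
  have h1 : Submodule.span ℂ {T | ∃ x y : E, T = rankOne x y}
      ≤ (Subalgebra.toSubmodule (toeplitzSubalgebra φ).toSubalgebra).comap (psiₗ φ) := by
    refine Submodule.span_le.2 ?_
    rintro _ ⟨x, y, rfl⟩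
    change psi φ (rankOne x y) ∈ toeplitzSubalgebra φ
    rw [psi_rankOne]
    exact mul_mem (creation_mem φ x) (star_mem (creation_mem φ y))
  have h2 : IsClosed (psi φ ⁻¹' (toeplitzSubalgebra φ : Set (Adjointable A (Fock φ)))) :=
    IsClosed.preimage (continuous_psi φ) inferInstance
  exact closure_minimal (fun x hx => h1 hx) h2 hk

/-- The canonical map `ψ₁ : K(E) → 𝒯_E`, with `ψ₁(|e⟩⟨f|) = e f⋆`. -/
def Toeplitz.psi₁ (k : Compacts A E) : Toeplitz φ := ⟨psi φ k, psi_mem φ k.2⟩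

/-- The ideal `J_E = φ⁻¹(K(E)) ∩ ker(φ)^⊥` of `A`. -/
def katsuraIdeal : Set A :=
  {a | φ a ∈ Compacts A E ∧ ∀ b, φ b = 0 → a * b = 0 ∧ b * a = 0}

/-- The elements `a - ψ₁(φ(a))`, `a ∈ J_E`, of `𝒯_E`. -/
def covarianceSet : Set (Toeplitz φ) :=
  {x | ∃ (a : A) (h : a ∈ katsuraIdeal φ), x = Toeplitz.ofA φ a - Toeplitz.psi₁ φ ⟨φ a, h.1⟩}

/-- The closed two-sided ideal of `𝒯_E` generated by the elements `a - ψ₁(φ(a))`, `a ∈ J_E`. -/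
def covarianceIdeal : Ideal (Toeplitz φ) :=
  (TwoSidedIdeal.asIdeal (TwoSidedIdeal.span (covarianceSet φ))).closure

instance : (covarianceIdeal φ).IsTwoSided where
  mul_mem_of_left b h :=
    map_mem_closure (f := fun x => x * b) (continuous_mul_const b) h fun _ hx =>
      TwoSidedIdeal.mul_mem_right _ _ _ hx

instance : IsClosed (covarianceIdeal φ : Set (Toeplitz φ)) := isClosed_closure

/-- The Cuntz-Pimsner algebra `𝒪_E`. -/
def CPAlgebra : Type _ := CStarQuotient (covarianceIdeal φ)

instance : CStarAlgebra (CPAlgebra φ) :=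
  inferInstanceAs (CStarAlgebra (CStarQuotient (covarianceIdeal φ)))

/-- The quotient map `𝒯_E → 𝒪_E`. -/
def CPAlgebra.mk : Toeplitz φ →⋆ₐ[ℂ] CPAlgebra φ where
  __ := CStarQuotient.mk (covarianceIdeal φ)
  commutes' _ := rfl
  map_star' _ := rfl

variable {φ} in
lemma CPAlgebra.mk_surjective : Function.Surjective (CPAlgebra.mk φ) :=
  CStarQuotient.mk_surjective

variable {φ} in
lemma CPAlgebra.mk_eq_zero {x : Toeplitz φ} : CPAlgebra.mk φ x = 0 ↔ x ∈ covarianceIdeal φ :=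
  Ideal.Quotient.eq_zero_iff_mem

/-- The copy of `a ∈ A` in `𝒪_E`. -/
def CPAlgebra.ofA (a : A) : CPAlgebra φ := CPAlgebra.mk φ (Toeplitz.ofA φ a)

/-- The copy of `e ∈ E` in `𝒪_E`. -/
def CPAlgebra.ofE (e : E) : CPAlgebra φ := CPAlgebra.mk φ (Toeplitz.ofE φ e)

end Algebras

section Gauge

variable {A : Type*} [CStarAlgebra A] [PartialOrder A] [StarOrderedRing A]
variable {E : Type*} [NormedAddCommGroup E] [NormedSpace ℂ E] [CompleteSpace E] [Module Aᵐᵒᵖ E]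
  [CStarModule Aᵐᵒᵖ E]
variable (φ : A →⋆ₐ[ℂ] Adjointable A E)

/-- The unitaries of the gauge action on the Fock space: `z` scales `E^{⊗ n}` by `z ^ n`. -/
def fockUnitary : Circle →* unitary (Adjointable A (Fock φ)) where
  toFun z := ⟨fockScale φ z, Unitary.mem_iff.2 (by
    rw [star_fockScale, ← fockScale_mul, ← fockScale_mul, inv_mul_cancel, mul_inv_cancel,
      fockScale_one]
    exact ⟨rfl, rfl⟩)⟩
  map_one' := Subtype.ext fockScale_one
  map_mul' z w := Subtype.ext (fockScale_mul z w)

/-- Conjugation by the gauge unitaries. -/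
def fockGauge : Circle →* (Adjointable A (Fock φ) ≃⋆ₐ[ℂ] Adjointable A (Fock φ)) :=
  (Unitary.conjStarAlgAut ℂ (Adjointable A (Fock φ))).comp (fockUnitary φ)

variable {φ}

lemma fockGauge_apply (z : Circle) (x : Adjointable A (Fock φ)) :
    fockGauge φ z x = fockScale φ z * x * star (fockScale φ z) := rfl

lemma fockGauge_leftMul (z : Circle) (a : A) : fockGauge φ z (leftMul φ a) = leftMul φ a :=
  fockScale_conj_fockRep z _

lemma fockGauge_psi (z : Circle) (k : Adjointable A E) : fockGauge φ z (psi φ k) = psi φ k :=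
  fockScale_conj_fockRep z _

lemma fockGauge_creation (z : Circle) (e : E) :
    fockGauge φ z (creation φ e) = (z : ℂ) • creation φ e :=
  fockScale_conj_creation z e

lemma norm_fockGauge (z : Circle) (x : Adjointable A (Fock φ)) : ‖fockGauge φ z x‖ = ‖x‖ :=
  StarAlgEquiv.norm_map _ x

lemma fockGauge_mem (z : Circle) {x : Adjointable A (Fock φ)} (hx : x ∈ toeplitzSubalgebra φ) :
    fockGauge φ z x ∈ toeplitzSubalgebra φ := by
  refine map_mem_closure_adjoin (fockGauge φ z) ?_ hx
  rintro _ (⟨a, rfl⟩ | ⟨e, rfl⟩)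
  · rw [fockGauge_leftMul]
    exact leftMul_mem φ a
  · rw [fockGauge_creation]
    exact smul_mem_starSubalgebra _ _ (creation_mem φ e)

lemma continuous_fockGauge {x : Adjointable A (Fock φ)} (hx : x ∈ toeplitzSubalgebra φ) :
    Continuous fun z : Circle => fockGauge φ z x := by
  let S : StarSubalgebra ℂ (Adjointable A (Fock φ)) :=
    { carrier := {x | Continuous fun z : Circle => fockGauge φ z x}
      mul_mem' := fun hx hy => by
        simp only [Set.mem_ofPred_eq, map_mul] at *
        exact hx.mul hy
      add_mem' := fun hx hy => by
        simp only [Set.mem_ofPred_eq, map_add] at *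
        exact hx.add hy
      algebraMap_mem' := fun c => by
        simp only [Set.mem_ofPred_eq, Algebra.algebraMap_eq_smul_one, map_smul, map_one]
        exact continuous_const
      star_mem' := fun hx => by
        simp only [Set.mem_ofPred_eq, map_star] at *
        exact hx.star }
  have h1 : toeplitzSubalgebra φ ≤ S := by
    refine StarSubalgebra.topologicalClosure_minimal (StarAlgebra.adjoin_le ?_) ?_
    · rintro _ (⟨a, rfl⟩ | ⟨e, rfl⟩)
      · change Continuous fun z : Circle => fockGauge φ z (leftMul φ a)
        simp only [fockGauge_leftMul]
        exact continuous_const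
      · change Continuous fun z : Circle => fockGauge φ z (creation φ e)
        simp only [fockGauge_creation]
        exact (continuous_subtype_val : Continuous fun z : Circle => (z : ℂ)).smul continuous_const
    · refine isClosed_of_closure_subset fun x hx => ?_
      refine continuous_of_uniform_approx_of_continuous fun u hu => ?_
      obtain ⟨ε, hε, hu⟩ := Metric.mem_uniformity_dist.1 hu
      obtain ⟨y, hy, hxy⟩ := Metric.mem_closure_iff.1 hx ε hε
      refine ⟨fun z => fockGauge φ z y, hy, fun z => hu ?_⟩
      rwa [dist_eq_norm, ← map_sub, norm_fockGauge, ← dist_eq_norm]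
  exact h1 hx

variable (φ) in
/-- The gauge automorphisms of `𝒯_E`. -/
def toeplitzGauge (z : Circle) : Toeplitz φ →⋆ₐ[ℂ] Toeplitz φ where
  toFun x := ⟨fockGauge φ z (Toeplitz.incl φ x), fockGauge_mem z x.2⟩
  map_one' := Toeplitz.ext (map_one (fockGauge φ z))
  map_mul' _ _ := Toeplitz.ext (map_mul (fockGauge φ z) _ _)
  map_zero' := Toeplitz.ext (map_zero (fockGauge φ z))
  map_add' _ _ := Toeplitz.ext (map_add (fockGauge φ z) _ _)
  commutes' c := Toeplitz.ext (AlgHomClass.commutes (fockGauge φ z) c)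
  map_star' _ := Toeplitz.ext (map_star (fockGauge φ z) _)

lemma toeplitzGauge_mem (z : Circle) {x : Toeplitz φ} (hx : x ∈ covarianceIdeal φ) :
    toeplitzGauge φ z x ∈ covarianceIdeal φ := by
  refine map_mem_closure (continuous_starAlgHom (toeplitzGauge φ z)) hx fun y hy => ?_
  have h1 : TwoSidedIdeal.span (covarianceSet φ)
      ≤ (TwoSidedIdeal.span (covarianceSet φ)).comap (toeplitzGauge φ z) := by
    refine TwoSidedIdeal.span_le.2 ?_
    rintro _ ⟨a, ha, rfl⟩
    refine (TwoSidedIdeal.mem_comap (toeplitzGauge φ z)).2 ?_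
    have : toeplitzGauge φ z (Toeplitz.ofA φ a - Toeplitz.psi₁ φ ⟨φ a, ha.1⟩)
        = Toeplitz.ofA φ a - Toeplitz.psi₁ φ ⟨φ a, ha.1⟩ := by
      rw [map_sub]
      congr 1
      · exact Toeplitz.ext (fockGauge_leftMul z a)
      · exact Toeplitz.ext (fockGauge_psi z (φ a))
    rw [this]
    exact TwoSidedIdeal.subset_span ⟨a, ha, rfl⟩
  exact (TwoSidedIdeal.mem_comap (toeplitzGauge φ z)).1 (h1 hy)

variable (φ) in
/-- The gauge automorphisms of `𝒪_E`. -/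
def cpGauge (z : Circle) : CPAlgebra φ →⋆ₐ[ℂ] CPAlgebra φ :=
  let f : CPAlgebra φ →+* CPAlgebra φ :=
    Ideal.Quotient.lift (covarianceIdeal φ)
      ((CPAlgebra.mk φ).comp (toeplitzGauge φ z) : Toeplitz φ →+* CPAlgebra φ)
      fun _ hx => CPAlgebra.mk_eq_zero.2 (toeplitzGauge_mem z hx)
  have hf : ∀ x, f (CPAlgebra.mk φ x) = CPAlgebra.mk φ (toeplitzGauge φ z x) := fun _ => rfl
  { f with
    commutes' := fun c => by
      change f (algebraMap ℂ (CPAlgebra φ) c) = _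
      rw [← AlgHomClass.commutes (CPAlgebra.mk φ) c, hf, AlgHomClass.commutes]
    map_star' := fun x => by
      obtain ⟨x, rfl⟩ := CPAlgebra.mk_surjective x
      change f (star (CPAlgebra.mk φ x)) = star (f (CPAlgebra.mk φ x))
      rw [← map_star, hf, hf, map_star, map_star] }

lemma cpGauge_mk (z : Circle) (x : Toeplitz φ) :
    cpGauge φ z (CPAlgebra.mk φ x) = CPAlgebra.mk φ (toeplitzGauge φ z x) := rfl

lemma cpGauge_mul (z w : Circle) (x : CPAlgebra φ) :
    cpGauge φ (z * w) x = cpGauge φ z (cpGauge φ w x) := by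
  obtain ⟨x, rfl⟩ := CPAlgebra.mk_surjective x
  rw [cpGauge_mk, cpGauge_mk, cpGauge_mk]
  congr 1
  refine Toeplitz.ext ?_
  change fockGauge φ (z * w) (Toeplitz.incl φ x) = fockGauge φ z (fockGauge φ w (Toeplitz.incl φ x))
  rw [map_mul]
  rfl

lemma cpGauge_one (x : CPAlgebra φ) : cpGauge φ 1 x = x := by
  obtain ⟨x, rfl⟩ := CPAlgebra.mk_surjective x
  rw [cpGauge_mk]
  congr 1
  refine Toeplitz.ext ?_
  change fockGauge φ 1 (Toeplitz.incl φ x) = Toeplitz.incl φ x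
  rw [map_one]
  rfl

lemma continuous_cpGauge (x : CPAlgebra φ) : Continuous fun z : Circle => cpGauge φ z x := by
  obtain ⟨x, rfl⟩ := CPAlgebra.mk_surjective x
  refine (continuous_starAlgHom (CPAlgebra.mk φ)).comp (?_ : Continuous fun z => toeplitzGauge φ z x)
  exact (continuous_fockGauge x.2).subtype_mk _

end Gauge

/-- A (strongly continuous) action of a topological group on a C⋆-algebra by automorphisms. -/
structure CStarAction (G B : Type*) [Group G] [TopologicalSpace G] [CStarAlgebra B] where
  /-- The underlying homomorphism to the automorphism group. -/
  toHom : G →* (B ≃⋆ₐ[ℂ] B)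
  /-- The orbit maps are continuous. -/
  continuous_orbit : ∀ b, Continuous fun g => toHom g b

namespace CStarAction

variable {G B : Type*} [Group G] [TopologicalSpace G] [CStarAlgebra B] (α : CStarAction G B)

/-- The coaction `ρ : B → B ⊗ C(G) = C(G, B)`, `ρ(b)(g) = g b`. -/
def coaction (b : B) : C(G, B) := ⟨fun g => α.toHom g b, α.continuous_orbit b⟩

/-- An action of a compact group on a unital C⋆-algebra is free if the linear span of the elements
`(a ⊗ 1) ρ(b)` is norm dense in `B ⊗ C(G) = C(G, B)`. -/
def IsFree [CompactSpace G] : Prop :=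
  Dense (Submodule.span ℂ {f : C(G, B) | ∃ a b : B, f = ContinuousMap.const G a * α.coaction b} :
    Set C(G, B))

end CStarAction

section Main

variable {A : Type*} [CStarAlgebra A] [PartialOrder A] [StarOrderedRing A]
variable {E : Type*} [NormedAddCommGroup E] [NormedSpace ℂ E] [CompleteSpace E] [Module Aᵐᵒᵖ E]
  [CStarModule Aᵐᵒᵖ E]
variable (φ : A →⋆ₐ[ℂ] Adjointable A E)

/-- The gauge action of the circle on `𝒪_E`. -/
def gaugeAction : CStarAction Circle (CPAlgebra φ) where
  toHom :=
    { toFun := fun z =>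
        { cpGauge φ z with
          invFun := cpGauge φ z⁻¹
          left_inv := fun x => by
            change cpGauge φ z⁻¹ (cpGauge φ z x) = x
            rw [← cpGauge_mul, inv_mul_cancel, cpGauge_one]
          right_inv := fun x => by
            change cpGauge φ z (cpGauge φ z⁻¹ x) = x
            rw [← cpGauge_mul, mul_inv_cancel, cpGauge_one]
          map_smul' := fun c x => map_smul (cpGauge φ z) c x }
      map_one' := StarAlgEquiv.ext fun x => cpGauge_one x
      map_mul' := fun z w => StarAlgEquiv.ext fun x => cpGauge_mul z w x }
  continuous_orbit := continuous_cpGauge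

lemma gaugeAction_ofA (z : Circle) (a : A) :
    (gaugeAction φ).toHom z (CPAlgebra.ofA φ a) = CPAlgebra.ofA φ a :=
  congrArg (CPAlgebra.mk φ) (Toeplitz.ext (fockGauge_leftMul z a))

lemma gaugeAction_ofE (z : Circle) (e : E) :
    (gaugeAction φ).toHom z (CPAlgebra.ofE φ e) = (z : ℂ) • CPAlgebra.ofE φ e := by
  rw [CPAlgebra.ofE, ← map_smul]
  exact congrArg (CPAlgebra.mk φ) (Toeplitz.ext (fockGauge_creation z e))

/-- The correspondence is faithful if the left action is one-to-one. -/
def IsFaithful : Prop := Function.Injective φ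

variable (A E) in
/-- The Hilbert module is full if the closed linear span of the inner products is all of `A`. -/
def IsFull : Prop :=
  (Submodule.span ℂ {a : A | ∃ x y : E, a = ip A x y}).topologicalClosure = ⊤

variable (A E) in
/-- The Hilbert module is (algebraically) finitely generated as a right `A`-module. -/
def IsFG : Prop := Module.Finite Aᵐᵒᵖ E

end Main

end CuntzPimsner

end

/-! Let `W` be the algebraic span of the elements `(a ⊗ 1) ρ(b)` in `C(𝕊¹, 𝒪_E)`. The first half of
the argument reduces freeness to two memberships, `1 ⊗ z ∈ W` and `1 ⊗ z̄ ∈ W`. Since `ρ` is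
multiplicative, `W` is stable under `v ↦ (a ⊗ 1) v ρ(b)`. Scalar functions are central, so `1 ⊗ f ∈
W` implies `f W ⊆ W` (`smul_mem_ellwoodSpan`). The functions `f` with `f W ⊆ W` form an algebra.
Once it contains `z` and `z̄` it contains all Laurent polynomials, and `W` contains `b ⊗ f` for each
of these. Stone-Weierstrass on the circle and a partition of unity then give density
(`isFree_of_circleCoord`).

The second half writes `1` in two ways. For `e, f ∈ E` the gauge action gives `(e⋆ ⊗ 1) ρ(f) = e⋆ f
⊗ z = ⟨e, f⟩ ⊗ z` and `(e ⊗ 1) ρ(f⋆) = e f⋆ ⊗ z̄ = ψ₁(|e⟩⟨f|) ⊗ z̄`.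

For `z` it is enough that `1 ∈ A` is a finite sum of inner products. By fullness their span is a
dense right ideal of the unital algebra `A`; it contains an invertible element, hence `1`
(`one_mem_span_ip`).

For `z̄` two facts are needed. First, `1 ∈ B(E)` is a finite sum of operators `|e⟩⟨f|`
(`one_mem_span_rankOne`). For generators `x₁, …, xₙ`, the open mapping theorem applied to `Aⁿ → E`
shows that the frame operator `F = ∑ |xᵢ⟩⟨xᵢ|` is bounded below. Being selfadjoint it is invertible,
and `1 = F⁻¹ F = ∑ |F⁻¹ xᵢ⟩⟨xᵢ|`. Second, `ψ₁(1) = 1` in `𝒪_E`. The identity is compact and `ker φ =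
0`, so `1 ∈ J_E`, and the covariance relation at `a = 1` is the claim (`CPAlgebra.mk_psi₁_one`). -/

noncomputable section

namespace CuntzPimsner

open MulOpposite

/-! ### Approximation of vector-valued continuous functions -/

section Density

/-- The functions `x ↦ f x • b` span a dense subspace of `C(X, B)` for compact Hausdorff `X`. -/
lemma mem_closure_of_smul_const_mem {X B : Type*} [TopologicalSpace X] [CompactSpace X] [T2Space X]
    [NormedAddCommGroup B] [NormedSpace ℂ B] (W : Submodule ℂ C(X, B))
    (hW : ∀ (f : C(X, ℂ)) (b : B), f • ContinuousMap.const X b ∈ W.topologicalClosure)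
    (F : C(X, B)) : F ∈ W.topologicalClosure := by
  -- Partitions of unity and convexity are real notions, so `B` is also regarded as a real space.
  let _ : NormedSpace ℝ B := NormedSpace.restrictScalars ℝ ℂ B
  refine W.isClosed_topologicalClosure.closure_subset
    (Metric.mem_closure_iff.2 fun ε hε => ?_)
  -- On `U x` the function `F` stays within `ε / 2` of its value at `x`. The approximant freezes `F`
  -- at finitely many centres and glues the values with a subordinate partition of unity. The margin
  -- `ε / 2` makes the final estimate strict after passing to closed balls.
  let U : X → Set X := fun x => F ⁻¹' Metric.ball (F x) (ε / 2)
  have hU : ∀ x, IsOpen (U x) := fun x => Metric.isOpen_ball.preimage F.continuous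
  obtain ⟨t, ht⟩ := CompactSpace.elim_nhds_subcover U
    fun x => (hU x).mem_nhds (Metric.mem_ball_self (half_pos hε))
  obtain ⟨p, hp⟩ := PartitionOfUnity.exists_isSubordinate isClosed_univ (fun i : t => U i)
    (fun i => hU i) (fun x _ => by
      have hx : x ∈ ⋃ y ∈ t, U y := by rw [ht]; trivial
      obtain ⟨y, hy, hxy⟩ := Set.mem_iUnion₂.1 hx
      exact Set.mem_iUnion.2 ⟨⟨y, hy⟩, hxy⟩)
  let q : t → C(X, ℂ) := fun i => ⟨fun x => (p i x : ℂ), by fun_prop⟩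
  refine ⟨∑ i, q i • ContinuousMap.const X (F i), Submodule.sum_mem _ fun i _ => hW _ _, ?_⟩
  refine lt_of_le_of_lt ((ContinuousMap.dist_le (half_pos hε).le).2 fun x => ?_) (half_lt_self hε)
  -- At `x` the approximant is a convex combination of the values `F i` with `p i x ≠ 0`. For these
  -- `x ∈ U i`, so `F i` lies in the convex ball of radius `ε / 2` around `F x`.
  have h := p.finsum_smul_mem_convex (g := fun i _ => F i) (Set.mem_univ x)
    (t := Metric.closedBall (F x) (ε / 2)) (fun i hi => by
      have hx : x ∈ U i := hp i (subset_closure hi)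
      rw [Metric.mem_closedBall, dist_comm]
      exact (Metric.mem_ball.1 hx).le) (convex_closedBall _ _)
  rw [finsum_eq_sum_of_fintype, Metric.mem_closedBall, dist_comm] at h
  convert h using 2
  rw [ContinuousMap.sum_apply]
  rfl

end Density

/-! ### Reduction of freeness to the functions `z` and `z̄` -/

section Free

variable {B : Type*} [CStarAlgebra B]

/-- The coordinate function of the circle. -/
def circleCoord : C(Circle, ℂ) := ⟨fun z => z, continuous_subtype_val⟩

/-- Stone-Weierstrass: the coordinate alone separates the points of the circle. -/
lemma adjoin_circleCoord_topologicalClosure :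
    (StarAlgebra.adjoin ℂ {circleCoord}).topologicalClosure = ⊤ := by
  refine ContinuousMap.starSubalgebra_topologicalClosure_eq_top_of_separatesPoints _ ?_
  intro z w hzw
  exact ⟨circleCoord, ⟨circleCoord, StarAlgebra.self_mem_adjoin_singleton ℂ _, rfl⟩,
    fun h => hzw (Subtype.ext h)⟩

namespace CStarAction

variable {G : Type*} [Group G] [TopologicalSpace G] (α : CStarAction G B)

/-- The linear span of the elements `(a ⊗ 1) ρ(b)`. -/
def ellwoodSpan : Submodule ℂ C(G, B) :=
  Submodule.span ℂ {f : C(G, B) | ∃ a b : B, f = ContinuousMap.const G a * α.coaction b}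

variable {α}

lemma const_mul_coaction_mem (a b : B) :
    ContinuousMap.const G a * α.coaction b ∈ α.ellwoodSpan :=
  Submodule.subset_span ⟨a, b, rfl⟩

lemma const_mem_ellwoodSpan (a : B) : ContinuousMap.const G a ∈ α.ellwoodSpan := by
  convert const_mul_coaction_mem (α := α) a 1
  ext g
  simp [coaction]

/-- A scalar function `f` with `1 ⊗ f` in the span of the `(a ⊗ 1) ρ(b)` multiplies that span into
itself. -/
lemma smul_mem_ellwoodSpan {f : C(G, ℂ)} (hf : f • (1 : C(G, B)) ∈ α.ellwoodSpan) {w : C(G, B)}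
    (hw : w ∈ α.ellwoodSpan) : f • w ∈ α.ellwoodSpan := by
  have key (a b : B) {v : C(G, B)} (hv : v ∈ α.ellwoodSpan) :
      ContinuousMap.const G a * v * α.coaction b ∈ α.ellwoodSpan := by
    induction hv using Submodule.span_induction with
    | mem v hv =>
      obtain ⟨c, d, rfl⟩ := hv
      convert const_mul_coaction_mem (α := α) (a * c) (d * b) using 1
      ext g
      simp [coaction, mul_assoc]
    | zero => simp
    | add v w _ _ hv hw => rw [mul_add, add_mul]; exact add_mem hv hw
    | smul c v _ hv => rw [mul_smul_comm, smul_mul_assoc]; exact Submodule.smul_mem _ _ hv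
  induction hw using Submodule.span_induction with
  | mem v hv =>
    obtain ⟨a, b, rfl⟩ := hv
    -- The function `f` is scalar, hence central: `f (a ⊗ 1) ρ(b) = (a ⊗ 1) (1 ⊗ f) ρ(b)`.
    convert key a b hf using 1
    ext g
    simp
  | zero => simp
  | add v w _ _ hv hw =>
    convert add_mem hv hw using 1
    ext g
    exact smul_add (f g) (v g) (w g)
  | smul c v _ hv =>
    convert Submodule.smul_mem _ c hv using 1
    ext g
    exact smul_comm (f g) c (v g)

/-- The circle acts freely as soon as `1 ⊗ z` and `1 ⊗ z̄` are in the span of the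
`(a ⊗ 1) ρ(b)`. -/
lemma isFree_of_circleCoord {α : CStarAction Circle B}
    (h₁ : circleCoord • (1 : C(Circle, B)) ∈ α.ellwoodSpan)
    (h₂ : star circleCoord • (1 : C(Circle, B)) ∈ α.ellwoodSpan) : α.IsFree := by
  -- The multipliers of the span. They are not known to be closed under `star`, which is why both
  -- `z` and `z̄` are assumed and the star subalgebra is treated below as the plain algebra
  -- generated by the two.
  let S : Subalgebra ℂ C(Circle, ℂ) :=
    { carrier := {f | ∀ w ∈ α.ellwoodSpan, f • w ∈ α.ellwoodSpan}
      mul_mem' := fun hf hg w hw => by rw [mul_smul]; exact hf _ (hg _ hw)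
      add_mem' := fun hf hg w hw => by rw [add_smul]; exact add_mem (hf _ hw) (hg _ hw)
      algebraMap_mem' := fun c w hw => by
        convert Submodule.smul_mem _ c hw using 1
        ext g
        simp }
  have hS : ∀ f ∈ StarAlgebra.adjoin ℂ {circleCoord}, f ∈ S := by
    have h : Algebra.adjoin ℂ ({circleCoord} ∪ star {circleCoord}) ≤ S := by
      refine Algebra.adjoin_le ?_
      rintro f (hf | hf)
      · rw [Set.mem_singleton_iff.1 hf]
        exact fun w hw => smul_mem_ellwoodSpan h₁ hw
      · rw [Set.star_singleton, Set.mem_singleton_iff] at hf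
        rw [hf]
        exact fun w hw => smul_mem_ellwoodSpan h₂ hw
    exact fun f hf => h hf
  intro F
  refine mem_closure_of_smul_const_mem α.ellwoodSpan (fun f b => ?_) F
  -- Composition with `m` is `f ↦ b ⊗ f`. Its continuity carries the inclusion from polynomials in
  -- `z, z̄` to the closure, which consists of all continuous functions.
  let m : C(ℂ, B) := ⟨fun c => c • b, by fun_prop⟩
  have hf : f ∈ (StarAlgebra.adjoin ℂ {circleCoord}).topologicalClosure := by
    rw [adjoin_circleCoord_topologicalClosure]; trivial
  exact map_mem_closure (f := fun f : C(Circle, ℂ) => m.comp f) (ContinuousMap.continuous_postcomp m)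
    hf fun g hg => hS g hg _ (const_mem_ellwoodSpan b)

end CStarAction

end Free

/-! ### Writing the units of `B(E)` and `A` as finite sums -/

section FinitelyGenerated

/-- A selfadjoint element `S` of a C⋆-algebra with `c ‖T‖ ≤ ‖S T‖` for all `T` is invertible. -/
lemma isUnit_of_le_norm_mul {R : Type*} [CStarAlgebra R] {S : R} (hS : IsSelfAdjoint S) {c : ℝ}
    (hc : 0 < c) (h : ∀ T : R, c * ‖T‖ ≤ ‖S * T‖) : IsUnit S := by
  rw [← spectrum.zero_notMem_iff ℝ]
  intro h0
  -- A tent with peak `f 0 = 1` that vanishes for `|t| ≥ c / 2`. If `0` is in the spectrum, `T =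
  -- f(S)` has norm at least `1`, while `|t f(t)| ≤ c / 2` bounds `‖S T‖` by `c / 2`. This
  -- contradicts `c ‖T‖ ≤ ‖S T‖`.
  let f : ℝ → ℝ := fun t => max 0 (1 - |t| / (c / 2))
  have hf : Continuous f := by fun_prop
  have h1 : 1 ≤ ‖cfc f S‖ := by
    have := norm_apply_le_norm_cfc f S h0 hf.continuousOn hS
    simpa [f] using this
  have h2 : S * cfc f S = cfc (fun t => t * f t) S := by
    rw [cfc_mul (fun t => t) f S, cfc_id' ℝ S]
  have h3 : ‖S * cfc f S‖ ≤ c / 2 := by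
    rw [h2]
    refine norm_cfc_le (by positivity) fun t _ => ?_
    rw [norm_mul, Real.norm_eq_abs, Real.norm_eq_abs, abs_of_nonneg (a := f t) (le_max_left _ _)]
    rcases le_total (|t|) (c / 2) with ht | ht
    · calc |t| * f t ≤ |t| * 1 := by
            gcongr
            exact max_le zero_le_one (sub_le_self _ (by positivity))
        _ ≤ c / 2 := by simpa using ht
    · have : f t = 0 := max_eq_left (sub_nonpos.2 ((one_le_div (by positivity)).2 ht))
      rw [this, mul_zero]
      positivity
  have := h (cfc f S)
  nlinarith

variable {A : Type*} [CStarAlgebra A] [PartialOrder A] [StarOrderedRing A]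
variable {E : Type*} [NormedAddCommGroup E] [NormedSpace ℂ E] [Module Aᵐᵒᵖ E]
  [CStarModule Aᵐᵒᵖ E]

/-- No compatibility of the two scalar actions on `E` is assumed; it is forced by the inner product,
which is linear for both and nondegenerate. -/
lemma op_smul_complex_smul (c : ℂ) (a : A) (x : E) : op (c • a) • x = c • op a • x :=
  ext_ip_left A fun z => by
    rw [ip_op_smul_right, ip_smul_right, ip_op_smul_right, mul_smul_comm]

variable (A) in
/-- The operator `(aᵢ) ↦ ∑ᵢ xᵢ aᵢ` from `Aⁿ` to `E`. -/
def synthesis {ι : Type*} [Fintype ι] (x : ι → E) : (ι → A) →L[ℂ] E :=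
  LinearMap.mkContinuous
    { toFun := fun a => ∑ i, op (a i) • x i
      map_add' := fun a b => by simp [add_smul, Finset.sum_add_distrib]
      map_smul' := fun c a => by
        simp only [Pi.smul_apply, op_smul_complex_smul, Finset.smul_sum, RingHom.id_apply] }
    (∑ i, ‖x i‖) fun a => by
      refine (norm_sum_le _ _).trans ?_
      rw [Finset.sum_mul]
      refine Finset.sum_le_sum fun i _ => (norm_op_smul_le A _ _).trans ?_
      rw [mul_comm]
      gcongr
      exact norm_le_pi_norm a i

lemma synthesis_apply {ι : Type*} [Fintype ι] (x : ι → E) (a : ι → A) :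
    synthesis A x a = ∑ i, op (a i) • x i := rfl

variable (A) in
/-- The frame operator `∑ᵢ |xᵢ⟩⟨xᵢ|`. -/
def frameOp {ι : Type*} [Fintype ι] (x : ι → E) : Adjointable A E := ∑ i, rankOne (x i) (x i)

lemma star_rankOne (x y : E) : star (rankOne x y : Adjointable A E) = rankOne y x :=
  Adjointable.ext_ip fun z w => by
    rw [← Adjointable.ip_apply_left, rankOne_apply, rankOne_apply, ip_op_smul_left, star_ip,
      ip_op_smul_right]

/-- This lets the inverse of the frame operator be absorbed into the elementary operators. -/
lemma mul_rankOne (T : Adjointable A E) (x y : E) : T * rankOne x y = rankOne (T x) y :=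
  Adjointable.ext_ip fun z w => by
    rw [Adjointable.mul_apply, Adjointable.ip_apply_right, rankOne_apply, rankOne_apply,
      ip_op_smul_right, ip_op_smul_right, Adjointable.ip_apply_right]

/-- For `y = z` the right side is a sum of positive elements `⟨y, xᵢ⟩ ⟨y, xᵢ⟩⋆`, so `⟨y, F y⟩`
controls every single coefficient `⟨y, xᵢ⟩`. -/
lemma ip_frameOp {ι : Type*} [Fintype ι] (x : ι → E) (y z : E) :
    ip A y (frameOp A x z) = ∑ i, ip A y (x i) * ip A (x i) z := by
  have h : frameOp A x z = ∑ i, (rankOne (x i) (x i) : Adjointable A E) z :=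
    map_sum (AddMonoidHom.mk' (fun T : Adjointable A E => T z) fun _ _ => rfl) _ _
  rw [h, ip_sum_right]
  exact Finset.sum_congr rfl fun i _ => by rw [rankOne_apply, ip_op_smul_right]

/-- The frame operator of a finite generating set is bounded below. -/
lemma exists_le_norm_frameOp [CompleteSpace E] {ι : Type*} [Fintype ι] (x : ι → E)
    (hx : Function.Surjective (synthesis A x)) :
    ∃ c > 0, ∀ y, c * ‖y‖ ≤ ‖frameOp A x y‖ := by
  -- Open mapping theorem: every `y` is `∑ xᵢ aᵢ` with coefficients of norm at most `C ‖y‖`.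
  obtain ⟨C, hC, h⟩ := (synthesis A x).exists_preimage_norm_le hx
  -- The summand `1` keeps `K` positive when the index type is empty.
  let K : ℝ := Fintype.card ι * C + 1
  have hK : 0 < K := by positivity
  refine ⟨(K ^ 2)⁻¹, by positivity, fun y => ?_⟩
  rcases eq_or_ne y 0 with rfl | hy
  · simp
  have hy' : 0 < ‖y‖ := norm_pos_iff.2 hy
  obtain ⟨a, ha, hn⟩ := h y
  -- A common bound for the coefficients `⟨y, xᵢ⟩`, since `‖⟨y, xᵢ⟩‖² ≤ ‖⟨y, F y⟩‖ ≤ ‖y‖ ‖F y‖`.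
  let s : ℝ := √(‖y‖ * ‖frameOp A x y‖)
  have h1 (i : ι) : ‖ip A y (x i)‖ ≤ s := by
    refine Real.le_sqrt_of_sq_le ?_
    calc ‖ip A y (x i)‖ ^ 2 = ‖ip A y (x i) * ip A (x i) y‖ := by
          rw [← star_ip A y (x i), CStarRing.norm_self_mul_star, sq]
      _ ≤ ‖∑ j, ip A y (x j) * ip A (x j) y‖ := by
          have hj (j : ι) : 0 ≤ ip A y (x j) * ip A (x j) y := by
            rw [← star_ip A y (x j)]
            exact mul_star_self_nonneg _
          exact CStarAlgebra.norm_le_norm_of_nonneg_of_le (hj i)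
            (Finset.single_le_sum (fun j _ => hj j) (Finset.mem_univ i))
      _ ≤ ‖y‖ * ‖frameOp A x y‖ := by
          rw [← ip_frameOp]
          exact norm_ip_le A _ _
  -- Only the second `y` of `⟨y, y⟩` is expanded as `∑ xᵢ aᵢ`; the first stays and produces the
  -- coefficients `⟨y, xᵢ⟩` bounded by `s`.
  have h2 : ‖y‖ ^ 2 ≤ K * s * ‖y‖ := by
    calc ‖y‖ ^ 2 = ‖∑ i, ip A y (x i) * a i‖ := by
          rw [norm_sq_eq A]
          conv_lhs => enter [1, 3]; rw [← ha, synthesis_apply]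
          simp only [ip_sum_right, ip_op_smul_right]
      _ ≤ ∑ _i : ι, s * (C * ‖y‖) :=
          (norm_sum_le _ _).trans (Finset.sum_le_sum fun i _ => (norm_mul_le _ _).trans
            (mul_le_mul (h1 i) ((norm_le_pi_norm a i).trans hn) (norm_nonneg _)
              (Real.sqrt_nonneg _)))
      _ = (K - 1) * s * ‖y‖ := by
          simp only [Finset.sum_const, Finset.card_univ, nsmul_eq_mul, K]
          ring
      _ ≤ K * s * ‖y‖ := by
          gcongr
          exact sub_le_self _ zero_le_one
  have h3 : ‖y‖ ≤ K * s := by nlinarith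
  -- Squaring removes the root in `s`; cancelling one factor `‖y‖` then leaves `‖y‖ ≤ K² ‖F y‖`.
  have h4 : ‖y‖ ^ 2 ≤ K ^ 2 * (‖y‖ * ‖frameOp A x y‖) := by
    calc ‖y‖ ^ 2 ≤ (K * s) ^ 2 := by gcongr
      _ = _ := by rw [mul_pow, Real.sq_sqrt (by positivity)]
  rw [inv_mul_le_iff₀ (by positivity)]
  nlinarith

/-- On a finitely generated Hilbert module the identity is a finite sum of elementary compact
operators. -/
lemma one_mem_span_rankOne [CompleteSpace E] (hfg : IsFG A E) :
    (1 : Adjointable A E) ∈ Submodule.span ℂ {T | ∃ x y : E, T = rankOne x y} := by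
  have _ : Module.Finite Aᵐᵒᵖ E := hfg
  obtain ⟨n, x, hx⟩ := Module.Finite.exists_fin (R := Aᵐᵒᵖ) (M := E)
  have hsurj : Function.Surjective (synthesis A x) := fun y => by
    have hy : y ∈ Submodule.span Aᵐᵒᵖ (Set.range x) := by rw [hx]; trivial
    obtain ⟨c, hc⟩ := (Submodule.mem_span_range_iff_exists_fun Aᵐᵒᵖ).1 hy
    exact ⟨fun i => (c i).unop, hc⟩
  obtain ⟨c, hc, h⟩ := exists_le_norm_frameOp x hsurj
  have hsa : IsSelfAdjoint (frameOp A x) := by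
    simp only [IsSelfAdjoint, frameOp, star_sum, star_rankOne]
  -- The lower bound on vectors, applied to `T y`, becomes the lower bound `c ‖T‖ ≤ ‖F T‖` on
  -- operators.
  obtain ⟨u, hu⟩ := isUnit_of_le_norm_mul hsa hc fun T => by
    rw [mul_comm, ← le_div_iff₀ hc]
    refine Adjointable.norm_le T (by positivity) fun y => ?_
    rw [div_mul_eq_mul_div, le_div_iff₀ hc, mul_comm]
    exact (h (T y)).trans (Adjointable.norm_apply_le (frameOp A x * T) y)
  -- This is `1 = F⁻¹ F`, with `F⁻¹` moved into the kets.
  have h1 : (1 : Adjointable A E) = ∑ i, rankOne ((↑u⁻¹ : Adjointable A E) (x i)) (x i) := by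
    rw [← u.inv_mul, hu, frameOp, Finset.mul_sum]
    exact Finset.sum_congr rfl fun i _ => mul_rankOne _ _ _
  rw [h1]
  exact Submodule.sum_mem _ fun i _ => Submodule.subset_span ⟨_, _, rfl⟩

/-- In a full Hilbert module over a unital C⋆-algebra the unit is a finite sum of inner products. -/
lemma one_mem_span_ip (hfull : IsFull A E) :
    (1 : A) ∈ Submodule.span ℂ {a : A | ∃ x y : E, a = ip A x y} := by
  have h : (1 : A) ∈ closure (Submodule.span ℂ {a : A | ∃ x y : E, a = ip A x y} : Set A) := by
    have : (1 : A) ∈ (Submodule.span ℂ {a : A | ∃ x y : E, a = ip A x y}).topologicalClosure := by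
      rw [show _ = _ from hfull]; trivial
    exact this
  -- Distance less than `1` from the unit suffices: the Neumann series makes `a` invertible.
  obtain ⟨a, ha, hd⟩ := Metric.mem_closure_iff.1 h 1 one_pos
  rw [dist_eq_norm] at hd
  obtain ⟨u, hu⟩ : IsUnit a := by
    have := (Units.oneSub (1 - a) hd).isUnit
    simpa using this
  -- The span, before closure, is a right ideal because `⟨x, y⟩ b = ⟨x, y b⟩`. Hence it contains `a
  -- a⁻¹ = 1`.
  have key (b : A) {d : A} (hd : d ∈ Submodule.span ℂ {a : A | ∃ x y : E, a = ip A x y}) :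
      d * b ∈ Submodule.span ℂ {a : A | ∃ x y : E, a = ip A x y} := by
    induction hd using Submodule.span_induction with
    | mem d hd =>
      obtain ⟨x, y, rfl⟩ := hd
      exact Submodule.subset_span ⟨x, op b • y, (ip_op_smul_right A b x y).symm⟩
    | zero => simp
    | add d e _ _ hd he => rw [add_mul]; exact add_mem hd he
    | smul c d _ hd => rw [smul_mul_assoc]; exact Submodule.smul_mem _ _ hd
  have := key (↑u⁻¹ : A) ha
  rwa [← hu, Units.mul_inv] at this

end FinitelyGenerated

/-! ### Relations in `𝒪_E` and the two elements of the span -/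

section Relations

variable {A : Type*} [CStarAlgebra A] [PartialOrder A] [StarOrderedRing A]
variable {E : Type*} [NormedAddCommGroup E] [NormedSpace ℂ E] [CompleteSpace E] [Module Aᵐᵒᵖ E]
  [CStarModule Aᵐᵒᵖ E]
variable (φ : A →⋆ₐ[ℂ] Adjointable A E)

/-- The Toeplitz relation `e⋆ f = ⟨e, f⟩`. On matrix coefficients it is the formula for `⟨e ⊗ x, f ⊗
y⟩` in a tensor product. -/
lemma star_creation_mul_creation (e f : E) :
    star (creation φ e) * creation φ f = leftMul φ (ip A e f) :=
  Fock.ext_form fun x y => by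
    rw [Adjointable.mul_apply, ← Adjointable.ip_apply_left, creation_mk, creation_mk, Fock.ip_mk,
      PreFock.form_create_create]
    exact (ip_fockOp _ x y).symm

/-- The copy of `A` in `𝒪_E`, as a homomorphism. -/
def CPAlgebra.ofAHom : A →⋆ₐ[ℂ] CPAlgebra φ :=
  (CPAlgebra.mk φ).comp ((leftMul φ).codRestrict (toeplitzSubalgebra φ) (leftMul_mem φ))

lemma CPAlgebra.ofAHom_ip (e f : E) :
    CPAlgebra.ofAHom φ (ip A e f) = star (CPAlgebra.ofE φ e) * CPAlgebra.ofE φ f := by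
  rw [CPAlgebra.ofE, CPAlgebra.ofE, ← map_star, ← map_mul]
  exact congrArg (CPAlgebra.mk φ) (Toeplitz.ext (star_creation_mul_creation φ e f).symm)

/-- Finite generation makes `φ(1) = 1` compact, and faithfulness makes `(ker φ)^⊥` all of `A`. -/
lemma one_mem_katsuraIdeal (hfaithful : IsFaithful φ) (hfg : IsFG A E) :
    (1 : A) ∈ katsuraIdeal φ := by
  refine ⟨?_, fun b hb => ?_⟩
  · rw [map_one]
    exact Submodule.le_topologicalClosure _ (one_mem_span_rankOne hfg)
  · have : b = 0 := hfaithful (by rw [hb, map_zero])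
    simp [this]

/-- If `1 ∈ J_E`, then the unit of `𝒪_E` is in the image of `ψ₁`. -/
lemma CPAlgebra.mk_psi₁_one (h : (1 : A) ∈ katsuraIdeal φ) (h1 : 1 ∈ Compacts A E) :
    CPAlgebra.mk φ (Toeplitz.psi₁ φ ⟨1, h1⟩) = 1 := by
  -- The covariance relation at `a = 1`. In the Toeplitz algebra `ψ₁(1)` acts as `0` on the summand
  -- `A` of the Fock space, so the passage to the quotient is essential.
  have hmem : Toeplitz.ofA φ 1 - Toeplitz.psi₁ φ ⟨φ 1, h.1⟩ ∈ covarianceIdeal φ :=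
    subset_closure (TwoSidedIdeal.subset_span ⟨1, h, rfl⟩)
  have h2 := CPAlgebra.mk_eq_zero.2 hmem
  rw [map_sub, sub_eq_zero] at h2
  have h3 : Toeplitz.ofA φ 1 = 1 := Toeplitz.ext (map_one (leftMul φ))
  rw [h3, map_one] at h2
  rw [h2]
  exact congrArg (CPAlgebra.mk φ) (Toeplitz.ext (congrArg (psi φ) (map_one φ).symm))

lemma CPAlgebra.mk_psi₁_rankOne (e f : E) (h : rankOne e f ∈ Compacts A E) :
    CPAlgebra.mk φ (Toeplitz.psi₁ φ ⟨rankOne e f, h⟩)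
      = CPAlgebra.ofE φ e * star (CPAlgebra.ofE φ f) := by
  rw [CPAlgebra.ofE, CPAlgebra.ofE, ← map_star, ← map_mul]
  exact congrArg (CPAlgebra.mk φ) (Toeplitz.ext (psi_rankOne e f))

/-- The linear map `b ↦ b ⊗ f` to `B ⊗ C(X) = C(X, B)`. -/
def tensorConst {X B : Type*} [TopologicalSpace X] [NormedAddCommGroup B] [NormedSpace ℂ B]
    (f : C(X, ℂ)) : B →ₗ[ℂ] C(X, B) where
  toFun b := f • ContinuousMap.const X b
  map_add' b c := ContinuousMap.ext fun x => smul_add (f x) b c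
  map_smul' c b := ContinuousMap.ext fun x => smul_comm (f x) c b

/-- By linearity it is enough to treat `a = ⟨e, f⟩`, where `a ⊗ z = (e⋆ ⊗ 1) ρ(f)`: the gauge action
multiplies `f` by `z`, and `e⋆ f = ⟨e, f⟩`. At `a = 1` this puts `1 ⊗ z` in the span. -/
lemma tensorConst_circleCoord_mem {a : A}
    (ha : a ∈ Submodule.span ℂ {a : A | ∃ x y : E, a = ip A x y}) :
    tensorConst circleCoord (CPAlgebra.ofAHom φ a) ∈ (gaugeAction φ).ellwoodSpan := by
  have h : Submodule.span ℂ {a : A | ∃ x y : E, a = ip A x y} ≤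
      (gaugeAction φ).ellwoodSpan.comap
        ((tensorConst circleCoord).comp (CPAlgebra.ofAHom φ).toAlgHom.toLinearMap) := by
    refine Submodule.span_le.2 ?_
    rintro _ ⟨e, f, rfl⟩
    change tensorConst circleCoord (CPAlgebra.ofAHom φ (ip A e f)) ∈ (gaugeAction φ).ellwoodSpan
    convert CStarAction.const_mul_coaction_mem (star (CPAlgebra.ofE φ e)) (CPAlgebra.ofE φ f) using 1
    ext z
    change (z : ℂ) • CPAlgebra.ofAHom φ (ip A e f)
      = star (CPAlgebra.ofE φ e) * (gaugeAction φ).toHom z (CPAlgebra.ofE φ f)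
    rw [gaugeAction_ofE, mul_smul_comm, CPAlgebra.ofAHom_ip]
  exact h ha

/-- `ψ₁` on the compact operators, as a linear map to `𝒪_E`. -/
def CPAlgebra.psi₁ₗ : Compacts A E →ₗ[ℂ] CPAlgebra φ :=
  (CPAlgebra.mk φ).toAlgHom.toLinearMap.comp
    { toFun := Toeplitz.psi₁ φ
      map_add' := fun k l => by
        refine Toeplitz.ext ?_
        rw [map_add]
        exact (psiₗ φ).map_add (k : Adjointable A E) l
      map_smul' := fun c k => by
        refine Toeplitz.ext ?_
        rw [RingHom.id_apply, map_smul]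
        exact (psiₗ φ).map_smul c (k : Adjointable A E) }

/-- The mirror image with `e f⋆` in place of `e⋆ f`: the gauge action multiplies `f⋆` by `z̄`, so
`(e ⊗ 1) ρ(f⋆) = ψ₁(|e⟩⟨f|) ⊗ z̄`. Finite sums, not limits, are used, so the result is in the span
itself. -/
lemma tensorConst_star_circleCoord_mem {k : Adjointable A E}
    (hk : k ∈ Submodule.span ℂ {T : Adjointable A E | ∃ x y : E, T = rankOne x y}) :
    tensorConst (star circleCoord)
        (CPAlgebra.psi₁ₗ φ ⟨k, Submodule.le_topologicalClosure _ hk⟩)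
      ∈ (gaugeAction φ).ellwoodSpan := by
  -- The argument of `L` carries a proof of compactness, so the induction runs on membership in the
  -- span and uses linearity of `L` case by case.
  let L := (tensorConst (star circleCoord)).comp (CPAlgebra.psi₁ₗ φ)
  change L _ ∈ _
  induction hk using Submodule.span_induction with
  | mem k hk =>
    obtain ⟨e, f, rfl⟩ := hk
    convert CStarAction.const_mul_coaction_mem (CPAlgebra.ofE φ e) (star (CPAlgebra.ofE φ f)) using 1
    ext z
    change star (z : ℂ) • CPAlgebra.mk φ (Toeplitz.psi₁ φ ⟨rankOne e f, _⟩)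
      = CPAlgebra.ofE φ e * (gaugeAction φ).toHom z (star (CPAlgebra.ofE φ f))
    rw [map_star, gaugeAction_ofE, star_smul, mul_smul_comm]
    exact congrArg (star (z : ℂ) • ·) (CPAlgebra.mk_psi₁_rankOne φ e f _)
  | zero =>
    convert Submodule.zero_mem _ using 1
    exact L.map_zero
  | add k l hk hl ihk ihl =>
    convert add_mem ihk ihl using 1
    exact L.map_add ⟨k, _⟩ ⟨l, _⟩
  | smul c k hk ih =>
    convert Submodule.smul_mem _ c ih using 1
    exact L.map_smul c ⟨k, _⟩

end Relations

end CuntzPimsner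

end

/-! ### Freeness of the gauge action -/

theorem mainTheorem4 {A : Type*} [CStarAlgebra A] [PartialOrder A] [StarOrderedRing A]
    {E : Type*} [NormedAddCommGroup E] [NormedSpace ℂ E] [CompleteSpace E] [Module Aᵐᵒᵖ E]
    [CStarModule Aᵐᵒᵖ E] (φ : A →⋆ₐ[ℂ] CuntzPimsner.Adjointable A E)
    (hfaithful : CuntzPimsner.IsFaithful φ) (hfull : CuntzPimsner.IsFull A E)
    (hfg : CuntzPimsner.IsFG A E) :
    (CuntzPimsner.gaugeAction φ).IsFree := by
  refine CuntzPimsner.CStarAction.isFree_of_circleCoord ?_ ?_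
  -- Fullness yields `1 ⊗ z`.
  · have h := CuntzPimsner.tensorConst_circleCoord_mem φ (CuntzPimsner.one_mem_span_ip hfull)
    rwa [map_one] at h
  -- Finite generation yields `ψ₁(1) ⊗ z̄`; faithfulness enters through `1 ∈ J_E`, which turns
  -- `ψ₁(1)` into `1`.
  · have h1 := CuntzPimsner.one_mem_span_rankOne hfg
    have h := CuntzPimsner.tensorConst_star_circleCoord_mem φ h1
    have h2 : CuntzPimsner.CPAlgebra.psi₁ₗ φ ⟨1, Submodule.le_topologicalClosure _ h1⟩ = 1 :=
      CuntzPimsner.CPAlgebra.mk_psi₁_one φ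
        (CuntzPimsner.one_mem_katsuraIdeal φ hfaithful hfg) _
    rwa [h2] at h
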